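/- **Setting.** Let $(\Omega,\mathcal F,\mathbb P)$ be a complete probability space and $(Z,\mathcal Z)$ a measurable space. A point function is a map $\theta:D(\theta)\to Z$ with $D(\theta)\subseteq(0,\infty)$ countable; the set $\pi(Z)$ of point functions carries the $\sigma$-algebra generated by the sets $\{\theta:\#\{t\in D(\theta):(t,\theta(t))\in U\}=k\}$, $k\in\mathbb N_0$, $U\in\mathfrak B((0,\infty))\otimes\mathcal Z$. Let $\Theta:\Omega\to\pi(Z)$ be measurable, let $N_\Theta(U,\omega)=\#\{t\in D(\Theta(\omega)):(t,\Theta(\omega)(t))\in U\}$ be its counting measure, and assume $\mathbb E\,N_\Theta((0,t]\times Z)<\infty$ for all $t>0$. Let $\alpha_0=0$ and let $\alpha_1<\alpha_2<\dots$ be the increasing enumeration of $D(\Theta(\omega))$ (which almost surely has finitely many points in each $(0,t]$); if $D(\Theta(\omega))$ has only $n$ points, put $\alpha_m=\infty$ for $m>n$. Let $V$ be a real separable Banach space with dual $V'$ and let $\mathcal A:V\to 2^V$ be a multivalued operator, $D(\mathcal A)=\{v:\mathcal Av\neq\emptyset\}$. Assume that $\mathcal A$ is m-accretive, i.e. $\|v_1-v_2\|\le\|v_1-v_2+\alpha(\hat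 v_1-\hat v_2)\|$ for all $\alpha>0$, $\hat v_i\in\mathcal Av_i$, and $R(\mathrm{Id}+\alpha\mathcal A)=V$ for all $\alpha>0$; and that $D(\mathcal A)$ is dense in $V$. Let $T_{\mathcal A}(\cdot)v$ be the unique mild solution of $0\in u'+\mathcal Au$ on $[0,\infty)$, $u(0)=v$, that is, the continuous $u$ with $u(0)=v$ such that for all $\tau,\varepsilon>0$ there are $0=s_0<\dots<s_N\le\tau$ with $\tau-\varepsilon<s_N$, $s_{i}-s_{i-1}<\varepsilon$, and $w_0,\dots,w_N\in V$ with $-\frac{w_{i}-w_{i-1}}{s_{i}-s_{i-1}}\in\mathcal Aw_{i}$ for $1\le i\le N$, $\|u(0)-w_0\|\le\varepsilon$ and $\|u(r)-w_{i}\|\le\varepsilon$ for $r\in(s_{i-1},s_i]$, $1\le i\le N$. Assume that $\mathcal A$ is domain invariant, i.e. $T_{\mathcal A}(t)v\in D(\mathcal A)$ for all $t>0$, $v\in V$, and that it has an infinitesimal generator $\mathcal A^\circ:V\to V$, i.e. $-\lim_{h\searrow0}\frac{T_{\mathcal A}(h)v-v}{h}=\mathcal A^\circ v\in\mathcal Av$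 for all $v\in D(\mathcal A)$ and $\mathcal A^\circ v=0$ for $v\notin D(\mathcal A)$. **Solutions.** Let $V^*\subseteq V'$ be a set that separates points, let $x:\Omega\to V$ and $\eta:(0,\infty)\times Z\times\Omega\to V$ be (jointly) measurable. A $\mathfrak B([0,\infty))\otimes\mathcal F$-measurable process $X:[0,\infty)\times\Omega\to V$ is a *strong solution* of $$\eta(t,z)\,N_\Theta(dt\otimes z)\in dX(t)+\mathcal AX(t)\,dt\qquad(\mathrm{ACPRM})\{x,\eta,V^*\}$$ if for $\mathbb P$-a.e. $\omega$: (i) $X(0)=x$; (ii) $X$ is càdlàg; (iii) $X(t)\in D(\mathcal A)$ for all $t\in(0,\infty)\setminus\{\alpha_m:m\ge1\}$; (iv) for all $m\ge0$ and $[a,b]\subseteq(\alpha_m,\alpha_{m+1})$, $X|_{[a,b]}$ is absolutely continuous and a.e. differentiable; (v) $\langle\Psi,\mathcal A^\circ X(\cdot)\rangle\in L^1(0,t)$ for all $t>0$, $\Psi\in V^*$; (vi) $\langle\Psi,X(t)-x\rangle+\int_0^t\langle\Psi,\mathcal A^\circ X(\tau)\rangle d\tau=\int_{(0,t]\times Z}\langle\Psi,\eta(\tau,z)\rangle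 N_\Theta(d\tau\otimes z)$ for all $t>0$, $\Psi\in V^*$. A $\mathfrak B([0,\infty))\otimes\mathcal F$-measurable process $Y$ is a *mild solution* of (ACPRM)$\{x,\eta,V^*\}$ if it satisfies (i)–(iv) almost surely and there are measurable $x_n,\eta_n$ and strong solutions $X_n$ of (ACPRM)$\{x_n,\eta_n,V^*\}$, $n \in \mathbb N$, such that almost surely, for all $t>0$, $\sup_{\tau\in[0,t]}\|X_n(\tau)-Y(\tau)\|\to0$ and $\int_{(0,t]\times Z}\|\eta_n(\tau,z)-\eta(\tau,z)\|N_\Theta(d\tau\otimes z)\to0$ as $n\to\infty$. The *process generated by* $(x,\eta)$ is $$\mathbb X(t)=\sum_{m=0}^\infty T_{\mathcal A}((t-\alpha_m)_+)(\mathbb X_m)\,1_{[\alpha_m,\alpha_{m+1})}(t),\quad t\ge0,$$ where $\mathbb X_0=x$, $\mathbb X_m=T_{\mathcal A}(\alpha_m-\alpha_{m-1})\mathbb X_{m-1}+\eta_m$ and $\eta_m=\eta(\alpha_m,\Theta(\alpha_m),\cdot)$ whenever $\alpha_m<\infty$. **Theorem.** Let $\mathcal V\subseteq V$ be a dense linear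 subspace with $T_{\mathcal A}(t)\mathcal V\subseteq\mathcal V$ for all $t\ge0$, and suppose that $\langle\Psi,\mathcal A^\circ T_{\mathcal A}(\cdot)u\rangle\in L^1(0,t)$ for all $t>0$, $u\in\mathcal V$, $\Psi\in V^*$. Then $\mathbb X$ is a mild solution of (ACPRM)$\{x,\eta,V^*\}$, and it is the only one up to indistinguishability: every mild solution $Y$ satisfies, almost surely, $Y(t)=\mathbb X(t)$ for all $t\ge0$. If moreover $(0,0)\in\mathcal A$, then almost surely, for all $t\ge0$, the following integral is finite and $$\|\mathbb X(t)\|\le\|x\|+\int_{(0,t]\times Z}\|\eta(\tau,z)\|\,N_\Theta(d\tau\otimes z).$$ -/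

import Mathlib

open MeasureTheory Set Filter
open scoped ENNReal Topology

noncomputable section

namespace ACPRM

/-! ### Point functions, point processes and their counting measures -/

/-- A point function: a map `D(θ) → Z` defined on a countable set `D(θ) ⊆ (0,∞)`. -/
structure PointFunction (Z : Type*) where
  dom : Set ℝ
  countable_dom : dom.Countable
  dom_pos : dom ⊆ Ioi 0
  toFun : dom → Z

section PointProcess

variable {Z : Type*} [MeasurableSpace Z]

/-- `#{t ∈ D(θ) : (t, θ(t)) ∈ U}`, a value in `ℕ ∪ {∞}`. -/
def PointFunction.numPoints (θ : PointFunction Z) (U : Set (ℝ × Z)) : ℕ∞ :=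
  {t : θ.dom | ((t : ℝ), θ.toFun t) ∈ U}.encard

/-- The σ-algebra on the space of point functions generated by the sets
`{θ : #{t ∈ D(θ) : (t, θ(t)) ∈ U} = k}`, for `k ∈ ℕ₀` and measurable `U ⊆ (0,∞) × Z`. -/
instance PointFunction.instMeasurableSpace : MeasurableSpace (PointFunction Z) :=
  MeasurableSpace.generateFrom
    {S | ∃ (k : ℕ) (U : Set (ℝ × Z)), MeasurableSet U ∧ U ⊆ Ioi 0 ×ˢ univ ∧
      S = {θ : PointFunction Z | θ.numPoints U = k}}

/-- The counting measure induced by a point function, as a measure on `ℝ × Z` which is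
concentrated on `(0,∞) × Z`. Its value on a measurable set is given by
`PointFunction.countingMeasure_apply` below. -/
def PointFunction.countingMeasure (θ : PointFunction Z) : Measure (ℝ × Z) :=
  Measure.sum fun t : θ.dom => Measure.dirac ((t : ℝ), θ.toFun t)

theorem PointFunction.countingMeasure_apply (θ : PointFunction Z) {U : Set (ℝ × Z)}
    (hU : MeasurableSet U) : θ.countingMeasure U = (θ.numPoints U : ℝ≥0∞) := by
  classical
  rw [PointFunction.countingMeasure, Measure.sum_apply _ hU, PointFunction.numPoints,
    ← ENNReal.tsum_set_one, tsum_subtype {t : θ.dom | ((t : ℝ), θ.toFun t) ∈ U} (fun _ => 1)]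
  refine tsum_congr fun t => ?_
  rw [Measure.dirac_apply' _ hU]
  rfl

/-- A point process `Θ` is finite if `𝔼 N_Θ((0,t] × Z) < ∞` for all `t > 0`. -/
def IsFinitePP {Ω : Type*} [MeasurableSpace Ω] (P : Measure Ω)
    (Θ : Ω → PointFunction Z) : Prop :=
  Measurable Θ ∧
    ∀ t : ℝ, 0 < t → ∫⁻ ω, (Θ ω).countingMeasure (Ioc 0 t ×ˢ univ) ∂P < ∞

/-- The hitting times `0 = α₀ < α₁ < α₂ < ⋯` which enumerate `D(θ)` increasingly:
`α₀ = 0`, and `α_{m+1}` is the first point of `D(θ)` after `α_m`. If `D(θ)` has only `n` points,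
then `α_m = ∞` for `m > n`. -/
def PointFunction.hittingTime (θ : PointFunction Z) : ℕ → ℝ≥0∞
  | 0 => 0
  | m + 1 => sInf {s | ∃ t ∈ θ.dom, s = ENNReal.ofReal t ∧ θ.hittingTime m < s}

end PointProcess

/-! ### Multivalued operators, mild solutions and the associated semigroup

A multivalued operator on `V` is a map `A : V → Set V`. -/

section Operators

variable {V : Type*} [NormedAddCommGroup V] [NormedSpace ℝ V]

/-- The domain `D(A) = {v : A v ≠ ∅}`. -/
def opDomain (A : V → Set V) : Set V := {v | (A v).Nonempty}

def IsAccretive (A : V → Set V) : Prop :=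
  ∀ α : ℝ, 0 < α → ∀ v₁ v₂ : V, ∀ w₁ ∈ A v₁, ∀ w₂ ∈ A v₂,
    ‖v₁ - v₂‖ ≤ ‖v₁ - v₂ + α • (w₁ - w₂)‖

/-- Accretive, and `R(Id + α A) = V` for all `α > 0`. -/
def IsMAccretive (A : V → Set V) : Prop :=
  IsAccretive A ∧ ∀ α : ℝ, 0 < α → ∀ f : V, ∃ v : V, ∃ w ∈ A v, v + α • w = f

/-- `u` is, on `[0,τ]`, uniformly `ε`-close to a solution of an implicit Euler scheme of mesh less
than `ε` for `0 ∈ u' + A u`: there are `0 = s₀ < s₁ < ⋯ < s_N` with `τ - ε < s_N ≤ τ` and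
`w₀, …, w_N` with `0 ∈ (w_{i+1} - w_i) / (s_{i+1} - s_i) + A w_{i+1}` such that `u` is `ε`-close to
the step function which is `w₀` at `0` and `w_{i+1}` on `(s_i, s_{i+1}]`. -/
def HasApproxSolution (A : V → Set V) (u : ℝ → V) (τ ε : ℝ) : Prop :=
  ∃ (N : ℕ) (s : ℕ → ℝ) (w : ℕ → V),
    s 0 = 0 ∧ s N ≤ τ ∧ τ - ε < s N ∧
    (∀ i < N, s i < s (i + 1) ∧ s (i + 1) - s i < ε ∧
      -((s (i + 1) - s i)⁻¹ • (w (i + 1) - w i)) ∈ A (w (i + 1))) ∧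
    ‖u 0 - w 0‖ ≤ ε ∧
    ∀ i < N, ∀ r ∈ Ioc (s i) (s (i + 1)), ‖u r - w (i + 1)‖ ≤ ε

/-- `u : [0,∞) → V` is a mild solution of `0 ∈ u' + A u`, `u(0) = v`. Only the values of `u` on
`[0,∞)` matter. -/
def IsMildSolutionCauchy (A : V → Set V) (v : V) (u : ℝ → V) : Prop :=
  ContinuousOn u (Ici 0) ∧ u 0 = v ∧
    ∀ τ : ℝ, 0 < τ → ∀ ε : ℝ, 0 < ε → HasApproxSolution A u τ ε

open Classical in
/-- The semigroup associated to `A`: `t ↦ semigroup A t v`, `t ≥ 0`, is the mild solution of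
`0 ∈ u' + A u`, `u(0) = v` (for m-accretive, densely defined `A` there is exactly one; the
values for `t < 0` are irrelevant, and so is the default value `0`). -/
def semigroup (A : V → Set V) (t : ℝ) (v : V) : V :=
  if h : ∃ u : ℝ → V, IsMildSolutionCauchy A v u then h.choose t else 0

/-- Invariance of a set `S` with respect to the semigroup `T_A`. -/
def IsInvariantSet (A : V → Set V) (S : Set V) : Prop :=
  ∀ t : ℝ, 0 ≤ t → ∀ v ∈ S, semigroup A t v ∈ S

/-- `T_A(t) v ∈ D(A)` for all `t > 0` and all `v ∈ V`. -/
def IsDomainInvariant (A : V → Set V) : Prop :=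
  ∀ t : ℝ, 0 < t → ∀ v : V, semigroup A t v ∈ opDomain A

/-- The single-valued map `G : V → V` is the infinitesimal generator `A°` of `T_A`. -/
def IsInfinitesimalGenerator (A : V → Set V) (G : V → V) : Prop :=
  (∀ v ∈ opDomain A,
    Tendsto (fun h : ℝ => -(h⁻¹ • (semigroup A h v - v))) (𝓝[>] 0) (𝓝 (G v)) ∧ G v ∈ A v) ∧
  ∀ v ∉ opDomain A, G v = 0

/-- A set of continuous functionals which separates the points of `V`. -/
def IsSeparatingSet (Vstar : Set (StrongDual ℝ V)) : Prop :=
  ∀ v : V, (∀ Ψ ∈ Vstar, Ψ v = 0) → v = 0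

/-- `f` restricted to `[a,b]` is absolutely continuous and differentiable almost everywhere. -/
def MemW11 (f : ℝ → V) (a b : ℝ) : Prop :=
  AbsolutelyContinuousOnInterval f a b ∧ ∀ᵐ t ∂volume.restrict (Icc a b), DifferentiableAt ℝ f t

/-- Right continuity and existence of left limits on `[0,∞)`. -/
def IsCadlag (f : ℝ → V) : Prop :=
  (∀ t : ℝ, 0 ≤ t → ContinuousWithinAt f (Ici t) t) ∧
    ∀ t : ℝ, 0 < t → ∃ l : V, Tendsto f (𝓝[<] t) (𝓝 l)

end Operators

/-! ### Solutions of `η(t,z) N_Θ(dt ⊗ z) ∈ dX(t) + A X(t) dt`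

Processes `X : [0,∞) × Ω → V` are represented by functions `X : ℝ → Ω → V` of which only the values
at times `t ≥ 0` matter, and integrands `η : (0,∞) × Z × Ω → V` by functions `ℝ → Z → Ω → V` of
which only the values at times `t > 0` matter. -/

section Solutions

variable {Ω Z V : Type*} [MeasurableSpace Ω] [MeasurableSpace Z]
  [NormedAddCommGroup V] [NormedSpace ℝ V] [MeasurableSpace V]

/-- `𝔅([0,∞)) ⊗ 𝓕`-measurability of a process indexed by `[0,∞)`. -/
def IsJointlyMeasurable (X : ℝ → Ω → V) : Prop :=
  Measurable fun p : Ici (0 : ℝ) × Ω => X p.1 p.2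

/-- `𝔅((0,∞)) ⊗ 𝓩 ⊗ 𝓕`-measurability of `η : (0,∞) × Z × Ω → V`. -/
def IsMeasurableDrift (η : ℝ → Z → Ω → V) : Prop :=
  Measurable fun p : Ioi (0 : ℝ) × Z × Ω => η p.1 p.2.1 p.2.2

/-- The pathwise conditions shared by strong and mild solutions, for a path `X`, an initial value
`x` and a point function `θ`. -/
structure IsRegularPath (A : V → Set V) (θ : PointFunction Z) (x : V) (X : ℝ → V) : Prop where
  initial : X 0 = x
  cadlag : IsCadlag X
  mem_domain : ∀ t : ℝ, 0 < t →
    (∀ m : ℕ, 1 ≤ m → ENNReal.ofReal t ≠ θ.hittingTime m) → X t ∈ opDomain A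
  memW11 : ∀ (m : ℕ) (a b : ℝ), a ≤ b → θ.hittingTime m < ENNReal.ofReal a →
    ENNReal.ofReal b < θ.hittingTime (m + 1) → MemW11 X a b

/-- `X` is a strong solution with data `{x, η, V*}`; `G` is the infinitesimal generator of `T_A`.
(The measure `N_Θ(·, ω)` restricted to `(0,t] × Z` is almost surely a finite sum of Dirac measures,
so that every measurable integrand is integrable.) -/
def IsStrongSolution (P : Measure Ω) (Θ : Ω → PointFunction Z) (A : V → Set V) (G : V → V)
    (Vstar : Set (StrongDual ℝ V)) (x : Ω → V) (η : ℝ → Z → Ω → V) (X : ℝ → Ω → V) : Prop :=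
  IsJointlyMeasurable X ∧
  ∀ᵐ ω ∂P, IsRegularPath A (Θ ω) (x ω) (fun t => X t ω) ∧
    (∀ t : ℝ, 0 < t → ∀ Ψ ∈ Vstar, IntegrableOn (fun τ => Ψ (G (X τ ω))) (Ioo 0 t)) ∧
    (∀ t : ℝ, 0 < t → ∀ Ψ ∈ Vstar,
      Ψ (X t ω - x ω) + ∫ τ in Ioo 0 t, Ψ (G (X τ ω)) =
        ∫ p in Ioc 0 t ×ˢ univ, Ψ (η p.1 p.2 ω) ∂(Θ ω).countingMeasure)

/-- `Y` is a mild solution with data `{x, η, V*}`: a limit of strong solutions, locally uniformly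
in time. -/
def IsMildSolution (P : Measure Ω) (Θ : Ω → PointFunction Z) (A : V → Set V) (G : V → V)
    (Vstar : Set (StrongDual ℝ V)) (x : Ω → V) (η : ℝ → Z → Ω → V) (Y : ℝ → Ω → V) : Prop :=
  IsJointlyMeasurable Y ∧
  (∀ᵐ ω ∂P, IsRegularPath A (Θ ω) (x ω) (fun t => Y t ω)) ∧
  ∃ (xs : ℕ → Ω → V) (ηs : ℕ → ℝ → Z → Ω → V) (Xs : ℕ → ℝ → Ω → V),
    (∀ n, Measurable (xs n) ∧ IsMeasurableDrift (ηs n)) ∧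
    (∀ n, IsStrongSolution P Θ A G Vstar (xs n) (ηs n) (Xs n)) ∧
    (∀ᵐ ω ∂P, ∀ t : ℝ, 0 < t →
      TendstoUniformlyOn (fun n τ => Xs n τ ω) (fun τ => Y τ ω) atTop (Icc 0 t)) ∧
    (∀ᵐ ω ∂P, ∀ t : ℝ, 0 < t →
      Tendsto (fun n => ∫⁻ p in Ioc 0 t ×ˢ univ,
          ‖ηs n p.1 p.2 ω - η p.1 p.2 ω‖ₑ ∂(Θ ω).countingMeasure) atTop (𝓝 0))

/-! ### The process generated by `(x, η)` -/

open Classical in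
/-- `η_m = η(α_m, Θ(α_m), ·)` for `m ≥ 1` (and `0` if there is no `m`-th point). -/
def jumpSize (Θ : Ω → PointFunction Z) (η : ℝ → Z → Ω → V) (m : ℕ) (ω : Ω) : V :=
  if h : ((Θ ω).hittingTime m).toReal ∈ (Θ ω).dom then
    η ((Θ ω).hittingTime m).toReal ((Θ ω).toFun ⟨_, h⟩) ω
  else 0

/-- The sequence of jumps generated by `(x, η)`:
`𝕏₀ = x`, `𝕏_{m+1} = T_A(α_{m+1} - α_m) 𝕏_m + η_{m+1}`. -/
def jumpSequence (A : V → Set V) (Θ : Ω → PointFunction Z) (x : Ω → V) (η : ℝ → Z → Ω → V) :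
    ℕ → Ω → V
  | 0, ω => x ω
  | m + 1, ω =>
      semigroup A ((Θ ω).hittingTime (m + 1) - (Θ ω).hittingTime m).toReal
        (jumpSequence A Θ x η m ω) + jumpSize Θ η (m + 1) ω

/-- The process generated by `(x, η)`:
`𝕏(t) = ∑_{m ≥ 0} T_A((t - α_m)₊) 𝕏_m 1_{[α_m, α_{m+1})}(t)` for `t ≥ 0`. For each `t` and `ω`
at most one summand is nonzero. -/
def generatedSol (A : V → Set V) (Θ : Ω → PointFunction Z) (x : Ω → V)
    (η : ℝ → Z → Ω → V) (t : ℝ) (ω : Ω) : V :=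
  ∑' m : ℕ, (Ico ((Θ ω).hittingTime m) ((Θ ω).hittingTime (m + 1))).indicator
    (fun _ => semigroup A (max (t - ((Θ ω).hittingTime m).toReal) 0) (jumpSequence A Θ x η m ω))
    (ENNReal.ofReal t)

end Solutions

end ACPRM

end

open ACPRM

/-! The semigroup comes from implicit Euler schemes. Kobayashi's inequality
`IsEulerScheme.norm_sub_le` compares two schemes through any point of the graph of `A`. Since `D(A)`
is dense, it makes resolvent iterates Cauchy and identifies the mild solution of the Cauchy problem
with their limit. Nonexpansivity and the semigroup law are then inherited from the iterates. Domain
invariance puts an orbit in `D(A)` after any positive time, so it is Lipschitz away from `0`. It has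
the right derivative `-A°` everywhere there, and integrating this derivative gives two-sided
differentiability a.e. in an arbitrary Banach space.

Almost surely only finitely many points lie in each bounded interval, so the problem becomes
pathwise: integrals against `N_Θ` are finite sums over the jumps, and between jumps the equation is
deterministic. There a strong solution satisfies `X' = -A° X` a.e., because countably many
functionals separate points. Accretivity makes its distance to the semigroup orbit nonincreasing
(`norm_le_of_dissipative`), so the two agree; at a jump the tested equation determines the new
value. Hence every strong solution is the generated process (`IsRegularPath.eq_generatedSol`).

Conversely, if the data take values in the invariant subspace, so do all post-jump values, and the
generated process satisfies the tested equation by telescoping (`integral_generatedSol`). General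
data are approximated uniformly by such data. Nonexpansivity bounds the difference of two generated
processes by the initial error plus the sum of the jump errors (`enorm_generatedSol_sub_le`); this
one estimate gives both existence and uniqueness of mild solutions. Comparison with the zero orbit
gives the final norm bound. -/

namespace ACPRM

/-! ### Implicit Euler schemes and Kobayashi's inequality -/

section Accretive

variable {V : Type*} [NormedAddCommGroup V] [NormedSpace ℝ V] {A : V → Set V}

/-- The basic inequality between one implicit Euler step of size `h` and one of size `k`. -/
theorem IsAccretive.step_le (hA : IsAccretive A) {h k : ℝ} (hh : 0 < h) (hk : 0 < k)
    {w₀ w₁ v₀ v₁ : V} (hw : -(h⁻¹ • (w₁ - w₀)) ∈ A w₁) (hv : -(k⁻¹ • (v₁ - v₀)) ∈ A v₁) :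
    (h + k) * ‖w₁ - v₁‖ ≤ k * ‖w₀ - v₁‖ + h * ‖w₁ - v₀‖ := by
  have hhk : 0 < h + k := by positivity
  have key := hA (h * k / (h + k)) (by positivity) w₁ v₁ _ hw _ hv
  have e : w₁ - v₁ + (h * k / (h + k)) • (-(h⁻¹ • (w₁ - w₀)) - -(k⁻¹ • (v₁ - v₀))) =
      (h + k)⁻¹ • (k • (w₀ - v₁) + h • (w₁ - v₀)) := by
    match_scalars <;> field_simp <;> ring
  rw [e, norm_smul, Real.norm_of_nonneg (by positivity), inv_mul_eq_div, le_div_iff₀ hhk] at key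
  calc (h + k) * ‖w₁ - v₁‖ = ‖w₁ - v₁‖ * (h + k) := mul_comm _ _
    _ ≤ _ := key
    _ ≤ ‖k • (w₀ - v₁)‖ + ‖h • (w₁ - v₀)‖ := norm_add_le _ _
    _ = _ := by rw [norm_smul, norm_smul, Real.norm_of_nonneg hk.le, Real.norm_of_nonneg hh.le]

/-- An implicit Euler step compared with a point of the graph. -/
theorem IsAccretive.step_graph_le (hA : IsAccretive A) {h : ℝ} (hh : 0 < h)
    {w₀ w₁ u z : V} (hw : -(h⁻¹ • (w₁ - w₀)) ∈ A w₁) (hz : z ∈ A u) :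
    ‖w₁ - u‖ ≤ ‖w₀ - u‖ + h * ‖z‖ := by
  have key := hA h hh w₁ u _ hw _ hz
  have e : w₁ - u + h • (-(h⁻¹ • (w₁ - w₀)) - z) = (w₀ - u) - h • z := by
    match_scalars <;> field_simp
    ring
  rw [e] at key
  refine key.trans ((norm_sub_le _ _).trans ?_)
  rw [norm_smul, Real.norm_of_nonneg hh.le]

/-- A (finite) implicit Euler scheme of mesh at most `h`. -/
def IsEulerScheme (A : V → Set V) (h : ℝ) (N : ℕ) (s : ℕ → ℝ) (w : ℕ → V) : Prop :=
  s 0 = 0 ∧ ∀ i < N, s i < s (i + 1) ∧ s (i + 1) - s i ≤ h ∧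
    -((s (i + 1) - s i)⁻¹ • (w (i + 1) - w i)) ∈ A (w (i + 1))

theorem IsEulerScheme.nonneg {h : ℝ} {N : ℕ} {s : ℕ → ℝ} {w : ℕ → V}
    (H : IsEulerScheme A h N s w) {i : ℕ} (hi : i ≤ N) : 0 ≤ s i := by
  induction i with
  | zero => exact H.1.ge
  | succ i ih => exact (ih (by omega)).trans (H.2 i (by omega)).1.le

/-- Summing the one-step bounds, the step sizes add up to `s i`. This is the boundary case of
Kobayashi's inequality. -/
theorem IsEulerScheme.norm_sub_graph_le (hA : IsAccretive A) {h : ℝ} {N : ℕ} {s : ℕ → ℝ}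
    {w : ℕ → V} (H : IsEulerScheme A h N s w) {u z : V} (hz : z ∈ A u) {i : ℕ} (hi : i ≤ N) :
    ‖w i - u‖ ≤ ‖w 0 - u‖ + s i * ‖z‖ := by
  induction i with
  | zero => simp [H.1]
  | succ i ih =>
    obtain ⟨h1, -, h3⟩ := H.2 i (by omega)
    have := hA.step_graph_le (sub_pos.2 h1) h3 hz
    have := ih (by omega)
    linarith

/-- Concavity of the square root with weights `k` and `h`; it propagates the square-root bound
through Kobayashi's recursion. -/
theorem weighted_sqrt_le {h k X Y Z : ℝ} (hh : 0 < h) (hk : 0 < k) (hX : 0 ≤ X) (hY : 0 ≤ Y)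
    (hZ : k * X + h * Y ≤ (h + k) * Z) : k * √X + h * √Y ≤ (h + k) * √Z := by
  have hZ0 : 0 ≤ Z := by
    have : 0 ≤ (h + k) * Z := le_trans (by positivity) hZ
    exact nonneg_of_mul_nonneg_right this (by positivity)
  have h1 := Real.sq_sqrt hX
  have h2 := Real.sq_sqrt hY
  have h3 := Real.sq_sqrt hZ0
  have hhk : 0 < h * k := by positivity
  refine (pow_le_pow_iff_left₀ (by positivity) (by positivity) two_ne_zero).1 ?_
  calc (k * √X + h * √Y) ^ 2 ≤ (h + k) * (k * X + h * Y) := by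
        have e : (h + k) * (k * X + h * Y) - (k * √X + h * √Y) ^ 2 = h * k * (√X - √Y) ^ 2 := by
          linear_combination (-(k ^ 2 + h * k)) * h1 - (h ^ 2 + h * k) * h2
        have := mul_nonneg hhk.le (sq_nonneg (√X - √Y))
        linarith
    _ ≤ (h + k) * ((h + k) * Z) := by gcongr
    _ = ((h + k) * √Z) ^ 2 := by rw [mul_pow, h3]; ring

/-- **Kobayashi's inequality** for two implicit Euler schemes. -/
theorem IsEulerScheme.norm_sub_le (hA : IsAccretive A) {h k : ℝ} {N M : ℕ} {s r : ℕ → ℝ}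
    {w v : ℕ → V} (H : IsEulerScheme A h N s w) (K : IsEulerScheme A k M r v)
    (hh : 0 ≤ h) (hk : 0 ≤ k) {u z : V} (hz : z ∈ A u) {i j : ℕ} (hi : i ≤ N) (hj : j ≤ M) :
    ‖w i - v j‖ ≤ ‖w 0 - u‖ + ‖v 0 - u‖ + ‖z‖ * √((s i - r j) ^ 2 + h * s i + k * r j) := by
  -- Double induction over the grid: on the axes one scheme has not moved and the graph estimate
  -- suffices; inside, `step_le` bounds the entry at `(i+1, j+1)` by those at `(i, j+1)` and `(i+1,
  -- j)`.
  induction i generalizing j with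
  | zero =>
    have h1 := K.norm_sub_graph_le hA hz hj
    have h2 : ‖w 0 - v j‖ ≤ ‖w 0 - u‖ + ‖v j - u‖ := by
      rw [norm_sub_rev (v j)]; exact norm_sub_le_norm_sub_add_norm_sub _ _ _
    have h3 : r j ≤ √((s 0 - r j) ^ 2 + h * s 0 + k * r j) := by
      apply Real.le_sqrt_of_sq_le
      have := mul_nonneg hk (K.nonneg hj)
      rw [H.1]; nlinarith
    nlinarith [mul_le_mul_of_nonneg_left h3 (norm_nonneg z)]
  | succ i ih =>
    induction j with
    | zero =>
      have h1 := H.norm_sub_graph_le hA hz hi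
      have h2 : ‖w (i + 1) - v 0‖ ≤ ‖w (i + 1) - u‖ + ‖v 0 - u‖ := by
        rw [norm_sub_rev (v 0)]; exact norm_sub_le_norm_sub_add_norm_sub _ _ _
      have h3 : s (i + 1) ≤ √((s (i + 1) - r 0) ^ 2 + h * s (i + 1) + k * r 0) := by
        apply Real.le_sqrt_of_sq_le
        have := mul_nonneg hh (H.nonneg hi)
        rw [K.1]; nlinarith
      nlinarith [mul_le_mul_of_nonneg_left h3 (norm_nonneg z)]
    | succ j ihj =>
      have e1 := ih (by omega) hj
      have e2 := ihj (by omega)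
      obtain ⟨a1, a2, a3⟩ := H.2 i (by omega)
      obtain ⟨b1, b2, b3⟩ := K.2 j (by omega)
      have si := H.nonneg (i := i) (by omega)
      have rj := K.nonneg (i := j) (by omega)
      set p := s (i + 1) - s i with hp
      set q := r (j + 1) - r j with hq
      have hp0 : 0 < p := sub_pos.2 a1
      have hq0 : 0 < q := sub_pos.2 b1
      have step := hA.step_le hp0 hq0 a3 b3
      have hs : s (i + 1) = s i + p := by rw [hp]; ring
      have hr : r (j + 1) = r j + q := by rw [hq]; ring
      -- Averaging the squares produces the excess `p q (p + q)`, while the two linear terms lose `p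
      -- q (h + k)`. The mesh bounds `p ≤ h` and `q ≤ k` absorb the excess.
      have sq := weighted_sqrt_le hp0 hq0 (X := (s i - r (j + 1)) ^ 2 + h * s i + k * r (j + 1))
        (Y := (s (i + 1) - r j) ^ 2 + h * s (i + 1) + k * r j)
        (Z := (s (i + 1) - r (j + 1)) ^ 2 + h * s (i + 1) + k * r (j + 1))
        (by rw [hr]; positivity) (by rw [hs]; positivity) (by
          rw [hs, hr]
          nlinarith [mul_nonneg (mul_pos hp0 hq0).le (sub_nonneg.2 a2),
            mul_nonneg (mul_pos hp0 hq0).le (sub_nonneg.2 b2)])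
      have hpq : 0 < p + q := by positivity
      refine le_of_mul_le_mul_left (step.trans ?_) hpq
      have f1 := mul_le_mul_of_nonneg_left e1 hq0.le
      have f2 := mul_le_mul_of_nonneg_left e2 hp0.le
      have f3 := mul_le_mul_of_nonneg_left sq (norm_nonneg z)
      linarith

/-- The horizon `τ + ε` forces the last node beyond `τ`; cutting the scheme at the first node not
before `t` leaves one that ends within one mesh size of `t`. -/
theorem HasApproxSolution.exists_euler {u : ℝ → V} {τ ε : ℝ} (hε : 0 < ε)
    (H : HasApproxSolution A u (τ + ε) ε) {t : ℝ} (ht0 : 0 ≤ t) (ht : t ≤ τ) :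
    ∃ (N : ℕ) (s : ℕ → ℝ) (w : ℕ → V), IsEulerScheme A ε N s w ∧ ‖u 0 - w 0‖ ≤ ε ∧
      |s N - t| ≤ ε ∧ ‖u t - w N‖ ≤ ε := by
  obtain ⟨N, s, w, h0, -, h2, h3, h4, h5⟩ := H
  rcases ht0.eq_or_lt with rfl | ht0
  · exact ⟨0, s, w, ⟨h0, by simp⟩, h4, by simp [h0, hε.le], h4⟩
  classical
  have hex : ∃ i, t ≤ s i := ⟨N, by linarith⟩
  obtain ⟨i, hi⟩ : ∃ i, Nat.find hex = i + 1 := Nat.exists_eq_succ_of_ne_zero (fun h => by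
    have := Nat.find_spec hex
    rw [h, h0] at this; linarith)
  have hi1 : t ≤ s (i + 1) := hi ▸ Nat.find_spec hex
  have hi2 : s i < t := not_le.1 (Nat.find_min hex (by omega))
  have hiN : i + 1 ≤ N := hi ▸ Nat.find_min' hex (by linarith)
  refine ⟨i + 1, s, w, ⟨h0, fun j hj => ?_⟩, h4, ?_, h5 i (by omega) t ⟨hi2, hi1⟩⟩
  · obtain ⟨a, b, c⟩ := h3 j (by omega)
    exact ⟨a, b.le, c⟩
  · obtain ⟨a, b, c⟩ := h3 i (by omega)
    rw [abs_le]; constructor <;> linarith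

/-- A mild solution compared with an implicit Euler scheme. -/
theorem IsMildSolutionCauchy.norm_sub_euler_le (hA : IsAccretive A) {v : V} {u : ℝ → V}
    (hu : IsMildSolutionCauchy A v u) {k : ℝ} (hk : 0 ≤ k) {M : ℕ} {r : ℕ → ℝ} {x : ℕ → V}
    (K : IsEulerScheme A k M r x) {y z : V} (hz : z ∈ A y) {t : ℝ} (ht : 0 ≤ t) :
    ‖u t - x M‖ ≤ ‖v - y‖ + ‖x 0 - y‖ + ‖z‖ * √((t - r M) ^ 2 + k * r M) := by
  -- Kobayashi's inequality is applied to an `ε`-scheme for `u` stopped near `t`; its mesh and all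
  -- its errors disappear as `ε → 0`.
  have bound : ∀ ε : ℝ, 0 < ε → ‖u t - x M‖ ≤ ε + (‖v - y‖ + ε + ‖x 0 - y‖ +
      ‖z‖ * √((|t - r M| + ε) ^ 2 + ε * (t + ε) + k * r M)) := by
    intro ε hε
    obtain ⟨N, s, w, H, h1, h2, h3⟩ := (hu.2.2 (t + 1 + ε) (by positivity) ε hε).exists_euler
      hε ht (by linarith)
    have key := H.norm_sub_le hA K hε.le hk hz le_rfl le_rfl
    rw [abs_le] at h2
    have sq : √((s N - r M) ^ 2 + ε * s N + k * r M) ≤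
        √((|t - r M| + ε) ^ 2 + ε * (t + ε) + k * r M) := by
      apply Real.sqrt_le_sqrt
      have : (s N - r M) ^ 2 ≤ (|t - r M| + ε) ^ 2 := by
        apply sq_le_sq'
        · linarith [neg_abs_le (t - r M)]
        · linarith [le_abs_self (t - r M)]
      have : ε * s N ≤ ε * (t + ε) := by gcongr; linarith
      linarith
    have n1 : ‖w 0 - y‖ ≤ ‖v - y‖ + ε := by
      rw [hu.2.1] at h1
      calc ‖w 0 - y‖ = ‖(v - y) - (v - w 0)‖ := by congr 1; abel
        _ ≤ _ := (_root_.norm_sub_le _ _).trans (by linarith)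
    have n2 : ‖u t - x M‖ ≤ ‖u t - w N‖ + ‖w N - x M‖ := norm_sub_le_norm_sub_add_norm_sub _ _ _
    have := mul_le_mul_of_nonneg_left sq (norm_nonneg z)
    linarith
  have lim : Tendsto (fun ε : ℝ => ε + (‖v - y‖ + ε + ‖x 0 - y‖ +
      ‖z‖ * √((|t - r M| + ε) ^ 2 + ε * (t + ε) + k * r M))) (𝓝[>] 0)
      (𝓝 (0 + (‖v - y‖ + 0 + ‖x 0 - y‖ +
      ‖z‖ * √((|t - r M| + 0) ^ 2 + 0 * (t + 0) + k * r M)))) :=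
    (Continuous.tendsto (by fun_prop) 0).mono_left nhdsWithin_le_nhds
  have := ge_of_tendsto lim (eventually_mem_nhdsWithin.mono fun ε hε => bound ε hε)
  simpa using this

end Accretive

/-! ### Resolvents and their iterates -/

section Resolvent

variable {V : Type*} [NormedAddCommGroup V] [NormedSpace ℝ V] {A : V → Set V}

open Classical in
/-- The resolvent `(Id + h A)⁻¹`. -/
noncomputable def resolvent (A : V → Set V) (h : ℝ) (f : V) : V :=
  if H : ∃ v : V, ∃ w ∈ A v, v + h • w = f then H.choose else f

theorem IsMAccretive.resolvent_mem (hA : IsMAccretive A) {h : ℝ} (hh : 0 < h) (f : V) :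
    -(h⁻¹ • (resolvent A h f - f)) ∈ A (resolvent A h f) := by
  have H := hA.2 h hh f
  rw [resolvent, dif_pos H]
  obtain ⟨w, hw, e⟩ := H.choose_spec
  convert hw using 1
  generalize H.choose = v at e
  subst e
  match_scalars <;> field_simp
  ring

/-- Accretivity with `α = h`: adding `h` times the selected values turns the two resolvents back
into `f` and `g`. -/
theorem IsMAccretive.norm_resolvent_sub_le (hA : IsMAccretive A) {h : ℝ} (hh : 0 < h) (f g : V) :
    ‖resolvent A h f - resolvent A h g‖ ≤ ‖f - g‖ := by
  have key := hA.1 h hh _ _ _ (hA.resolvent_mem hh f) _ (hA.resolvent_mem hh g)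
  refine key.trans_eq (congrArg _ ?_)
  match_scalars <;> field_simp <;> ring

theorem IsMAccretive.norm_iterate_resolvent_sub_le (hA : IsMAccretive A) {h : ℝ} (hh : 0 < h)
    (n : ℕ) (f g : V) : ‖(resolvent A h)^[n] f - (resolvent A h)^[n] g‖ ≤ ‖f - g‖ := by
  induction n with
  | zero => simp
  | succ n ih =>
    simp only [Function.iterate_succ_apply']
    exact (hA.norm_resolvent_sub_le hh _ _).trans ih

theorem IsMAccretive.isEulerScheme_iterate (hA : IsMAccretive A) {h : ℝ} (hh : 0 < h) (N : ℕ)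
    (v : V) : IsEulerScheme A h N (fun i => i * h) (fun i => (resolvent A h)^[i] v) := by
  refine ⟨by simp, fun i _ => ⟨?_, ?_, ?_⟩⟩
  · push_cast; linarith
  · push_cast; linarith
  · have : ((i + 1 : ℕ) : ℝ) * h - i * h = h := by push_cast; ring
    simp only [this, Function.iterate_succ_apply']
    exact hA.resolvent_mem hh _

theorem IsMAccretive.norm_iterate_sub_iterate_le (hA : IsMAccretive A) {h k : ℝ} (hh : 0 < h)
    (hk : 0 < k) (i j : ℕ) (v : V) {y z : V} (hz : z ∈ A y) :
    ‖(resolvent A h)^[i] v - (resolvent A k)^[j] v‖ ≤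
      ‖v - y‖ + ‖v - y‖ + ‖z‖ * √((i * h - j * k) ^ 2 + h * (i * h) + k * (j * k)) :=
  (hA.isEulerScheme_iterate hh i v).norm_sub_le hA.1 (hA.isEulerScheme_iterate hk j v) hh.le hk.le
    hz le_rfl le_rfl

end Resolvent

/-- The graph point `y` is fixed near `v` before the limit is taken, so the possibly large factor
`‖z‖` is harmless. This is how density of the domain enters. -/
theorem tendsto_zero_of_graph_bound {V : Type*} [NormedAddCommGroup V] {A : V → Set V}
    (hdense : Dense (opDomain A)) {ι : Type*} {l : Filter ι} {v : V}
    {f g : ι → ℝ} (hf : ∀ i, 0 ≤ f i) (hg : Tendsto g l (𝓝 0))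
    (H : ∀ y, ∀ z ∈ A y, ∀ᶠ i in l, f i ≤ ‖v - y‖ + ‖v - y‖ + ‖z‖ * g i) :
    Tendsto f l (𝓝 0) := by
  rw [tendsto_order]
  refine ⟨fun a ha => Eventually.of_forall fun i => ha.trans_le (hf i), fun ε hε => ?_⟩
  obtain ⟨y, ⟨z, hz⟩, hy⟩ := hdense.exists_dist_lt v (show 0 < ε / 4 by positivity)
  have h1 : Tendsto (fun i => ‖z‖ * g i) l (𝓝 0) := by simpa using hg.const_mul ‖z‖
  filter_upwards [H y z hz, h1.eventually (gt_mem_nhds (show 0 < ε / 2 by positivity))] with i a b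
  rw [dist_eq_norm] at hy
  linarith

/-! ### Construction and regularity of the contraction semigroup -/

section Semigroup

variable {V : Type*} [NormedAddCommGroup V] [NormedSpace ℝ V] {A : V → Set V} {G : V → V}

/-- Step size of the approximating implicit Euler schemes. -/
noncomputable def eulerStep (n : ℕ) : ℝ := 1 / ((n : ℝ) + 1)

theorem eulerStep_pos (n : ℕ) : 0 < eulerStep n := Nat.one_div_pos_of_nat

theorem tendsto_eulerStep : Tendsto eulerStep atTop (𝓝 0) := tendsto_one_div_add_atTop_nhds_zero_nat

theorem tendsto_ceil_mul_eulerStep {t : ℝ} (ht : 0 ≤ t) :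
    Tendsto (fun n => ⌈t / eulerStep n⌉₊ * eulerStep n) atTop (𝓝 t) := by
  have h2 : Tendsto (fun n => t + eulerStep n) atTop (𝓝 t) := by
    simpa using tendsto_eulerStep.const_add t
  refine tendsto_of_tendsto_of_tendsto_of_le_of_le tendsto_const_nhds h2 (fun n => ?_) fun n => ?_
  · have := mul_le_mul_of_nonneg_right (Nat.le_ceil (t / eulerStep n)) (eulerStep_pos n).le
    rwa [div_mul_cancel₀ _ (eulerStep_pos n).ne'] at this
  · have := mul_le_mul_of_nonneg_right
      (Nat.ceil_lt_add_one (div_nonneg ht (eulerStep_pos n).le)).le (eulerStep_pos n).le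
    rwa [add_mul, one_mul, div_mul_cancel₀ _ (eulerStep_pos n).ne'] at this

/-- Crandall–Liggett convergence: both elapsed times tend to `t` and both meshes to `0`, so the
radicand in Kobayashi's inequality vanishes. -/
theorem exists_tendsto_iterate_resolvent [CompleteSpace V] (hA : IsMAccretive A)
    (hdense : Dense (opDomain A)) (v : V) {t : ℝ} {k : ℕ → ℕ}
    (hk : Tendsto (fun n => k n * eulerStep n) atTop (𝓝 t)) :
    ∃ l, Tendsto (fun n => (resolvent A (eulerStep n))^[k n] v) atTop (𝓝 l) := by
  refine cauchySeq_tendsto_of_complete (cauchySeq_iff_tendsto_dist_atTop_0.2 ?_)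
  refine tendsto_zero_of_graph_bound hdense (v := v) (fun _ => dist_nonneg)
    (g := fun p : ℕ × ℕ => √((k p.1 * eulerStep p.1 - k p.2 * eulerStep p.2) ^ 2 +
      eulerStep p.1 * (k p.1 * eulerStep p.1) + eulerStep p.2 * (k p.2 * eulerStep p.2))) ?_
    fun y z hz => Eventually.of_forall fun p => ?_
  · have e1 : Tendsto (fun p : ℕ × ℕ => k p.1 * eulerStep p.1) atTop (𝓝 t) := by
      rw [← prod_atTop_atTop_eq]; exact hk.comp tendsto_fst
    have e2 : Tendsto (fun p : ℕ × ℕ => k p.2 * eulerStep p.2) atTop (𝓝 t) := by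
      rw [← prod_atTop_atTop_eq]; exact hk.comp tendsto_snd
    have e3 : Tendsto (fun p : ℕ × ℕ => eulerStep p.1) atTop (𝓝 0) := by
      rw [← prod_atTop_atTop_eq]; exact tendsto_eulerStep.comp tendsto_fst
    have e4 : Tendsto (fun p : ℕ × ℕ => eulerStep p.2) atTop (𝓝 0) := by
      rw [← prod_atTop_atTop_eq]; exact tendsto_eulerStep.comp tendsto_snd
    simpa using ((((e1.sub e2).pow 2).add (e3.mul e1)).add (e4.mul e2)).sqrt
  · rw [dist_eq_norm]
    exact hA.norm_iterate_sub_iterate_le (eulerStep_pos _) (eulerStep_pos _) _ _ v hz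

/-- The bound `h1` gives continuity, and `h2` makes the resolvent iterates with a small constant
step the required approximating schemes. -/
theorem isMildSolutionCauchy_of_bound (hA : IsMAccretive A)
    (hdense : Dense (opDomain A)) {v : V} {u : ℝ → V} (hu0 : u 0 = v)
    (h1 : ∀ y, ∀ z ∈ A y, ∀ t, 0 ≤ t → ∀ s, 0 ≤ s →
      ‖u t - u s‖ ≤ ‖v - y‖ + ‖v - y‖ + ‖z‖ * |t - s|)
    (h2 : ∀ y, ∀ z ∈ A y, ∀ t, 0 ≤ t → ∀ h, 0 < h → ∀ i : ℕ,
      ‖u t - (resolvent A h)^[i] v‖ ≤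
        ‖v - y‖ + ‖v - y‖ + ‖z‖ * √((t - i * h) ^ 2 + h * (i * h))) :
    IsMildSolutionCauchy A v u := by
  refine ⟨fun t ht => ?_, hu0, fun τ hτ ε hε => ?_⟩
  · refine tendsto_iff_norm_sub_tendsto_zero.2 (tendsto_zero_of_graph_bound hdense (v := v)
      (fun _ => norm_nonneg _) (g := fun s => |s - t|) ?_ fun y z hz => ?_)
    · have : Tendsto (fun s : ℝ => |s - t|) (𝓝 t) (𝓝 |t - t|) :=
        Continuous.tendsto (by fun_prop) t
      simp only [sub_self, abs_zero] at this
      exact this.mono_left nhdsWithin_le_nhds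
    · filter_upwards [self_mem_nhdsWithin] with s hs using h1 y z hz s hs t ht
  · obtain ⟨y, ⟨z, hz⟩, hy⟩ := hdense.exists_dist_lt v (show 0 < ε / 4 by positivity)
    rw [dist_eq_norm] at hy
    have lim : Tendsto (fun h : ℝ => ‖z‖ * √(h ^ 2 + h * τ)) (𝓝[>] 0) (𝓝 0) := by
      have : Tendsto (fun h : ℝ => ‖z‖ * √(h ^ 2 + h * τ)) (𝓝 0) (𝓝 (‖z‖ * √(0 ^ 2 + 0 * τ))) :=
        Continuous.tendsto (by fun_prop) 0
      simp only [ne_eq, OfNat.ofNat_ne_zero, not_false_eq_true, zero_pow, zero_mul, add_zero,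
        Real.sqrt_zero, mul_zero] at this
      exact this.mono_left nhdsWithin_le_nhds
    -- Such an `h` meets the mesh condition, and the total error is below `ε/4 + ε/4 + ε/2`.
    obtain ⟨h, hh1, hh2, hh0⟩ := ((lim.eventually (gt_mem_nhds (show 0 < ε / 2 by positivity))).and
      ((eventually_mem_nhdsWithin).and (nhdsWithin_le_nhds (gt_mem_nhds hε)))).exists
    have hh : 0 < h := hh2
    have fl : ⌊τ / h⌋₊ * h ≤ τ := by
      have := mul_le_mul_of_nonneg_right (Nat.floor_le (div_nonneg hτ.le hh.le)) hh.le
      rwa [div_mul_cancel₀ _ hh.ne'] at this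
    -- With the floor, the last node lies in `(τ - h, τ]`.
    refine ⟨⌊τ / h⌋₊, fun i => i * h, fun i => (resolvent A h)^[i] v, by simp, fl, ?_,
      fun i _ => ?_, by simp [hu0, hε.le], fun i hi r hr => ?_⟩
    · have := mul_lt_mul_of_pos_right (Nat.lt_floor_add_one (τ / h)) hh
      rw [div_mul_cancel₀ _ hh.ne', add_mul, one_mul] at this
      have : h < ε := hh0
      linarith
    · have e : ((i + 1 : ℕ) : ℝ) * h - i * h = h := by push_cast; ring
      obtain ⟨-, H⟩ := hA.isEulerScheme_iterate hh (i + 1) v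
      obtain ⟨a, -, c⟩ := H i (by omega)
      exact ⟨a, by rw [e]; exact hh0, c⟩
    · have b := h2 y z hz r (le_trans (by positivity) hr.1.le) h hh (i + 1)
      have hi' : ((i + 1 : ℕ) : ℝ) * h ≤ τ := by
        refine le_trans ?_ fl
        gcongr
        exact hi
      have sq : √((r - (i + 1 : ℕ) * h) ^ 2 + h * ((i + 1 : ℕ) * h)) ≤ √(h ^ 2 + h * τ) := by
        apply Real.sqrt_le_sqrt
        have r1 := hr.1
        have r2 := hr.2
        push_cast at r2
        have : (r - (i + 1 : ℕ) * h) ^ 2 ≤ h ^ 2 := by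
          apply sq_le_sq'
          · push_cast; linarith
          · push_cast; linarith
        have := mul_le_mul_of_nonneg_left hi' hh.le
        linarith
      have := mul_le_mul_of_nonneg_left sq (norm_nonneg z)
      linarith

variable [CompleteSpace V]

theorem exists_isMildSolutionCauchy (hA : IsMAccretive A) (hdense : Dense (opDomain A)) (v : V) :
    ∃ u : ℝ → V, IsMildSolutionCauchy A v u := by
  -- The truncation `max t 0` only makes the limit available for every real `t`.
  have hex : ∀ t : ℝ, ∃ l, Tendsto
      (fun n => (resolvent A (eulerStep n))^[⌈max t 0 / eulerStep n⌉₊] v) atTop (𝓝 l) := fun t =>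
    exists_tendsto_iterate_resolvent hA hdense v (tendsto_ceil_mul_eulerStep (le_max_right t 0))
  choose u hu using hex
  refine ⟨u, isMildSolutionCauchy_of_bound hA hdense ?_ ?_ ?_⟩
  · refine tendsto_nhds_unique (hu 0) ?_
    simp
  · intro y z hz t ht s hs
    have ht' := hu t
    have hs' := hu s
    rw [max_eq_left ht] at ht'
    rw [max_eq_left hs] at hs'
    have p1 := tendsto_ceil_mul_eulerStep ht
    have p2 := tendsto_ceil_mul_eulerStep hs
    have lim := (((((p1.sub p2).pow 2).add (tendsto_eulerStep.mul p1)).add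
      (tendsto_eulerStep.mul p2)).sqrt.const_mul ‖z‖).const_add (‖v - y‖ + ‖v - y‖)
    have := le_of_tendsto_of_tendsto' (ht'.sub hs').norm lim fun n =>
      hA.norm_iterate_sub_iterate_le (eulerStep_pos n) (eulerStep_pos n) _ _ v hz
    simpa [Real.sqrt_sq_eq_abs] using this
  · intro y z hz t ht h hh i
    have ht' := hu t
    rw [max_eq_left ht] at ht'
    have p1 := tendsto_ceil_mul_eulerStep ht
    have lim := (((((p1.sub_const (i * h)).pow 2).add (tendsto_eulerStep.mul p1)).add_const
      (h * (i * h))).sqrt.const_mul ‖z‖).const_add (‖v - y‖ + ‖v - y‖)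
    have := le_of_tendsto_of_tendsto' (ht'.sub_const ((resolvent A h)^[i] v)).norm lim fun n =>
      hA.norm_iterate_sub_iterate_le (eulerStep_pos n) hh _ _ v hz
    simpa using this

theorem isMildSolutionCauchy_semigroup (hA : IsMAccretive A) (hdense : Dense (opDomain A)) (v : V) :
    IsMildSolutionCauchy A v (fun t => semigroup A t v) := by
  have h := exists_isMildSolutionCauchy hA hdense v
  simp only [semigroup, dif_pos h]
  exact h.choose_spec

theorem semigroup_zero (hA : IsMAccretive A) (hdense : Dense (opDomain A)) (v : V) :
    semigroup A 0 v = v :=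
  (isMildSolutionCauchy_semigroup hA hdense v).2.1

/-- The exponential formula. -/
theorem tendsto_iterate_resolvent_semigroup (hA : IsMAccretive A) (hdense : Dense (opDomain A))
    (v : V) {t : ℝ} (ht : 0 ≤ t) {k : ℕ → ℕ}
    (hk : Tendsto (fun n => k n * eulerStep n) atTop (𝓝 t)) :
    Tendsto (fun n => (resolvent A (eulerStep n))^[k n] v) atTop (𝓝 (semigroup A t v)) := by
  refine tendsto_iff_norm_sub_tendsto_zero.2 (tendsto_zero_of_graph_bound hdense (v := v)
      (fun _ => norm_nonneg _)
      (g := fun n => √((t - k n * eulerStep n) ^ 2 + eulerStep n * (k n * eulerStep n))) ?_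
      fun y z hz => Eventually.of_forall fun n => ?_)
  · simpa using (((hk.const_sub t).pow 2).add (tendsto_eulerStep.mul hk)).sqrt
  · rw [norm_sub_rev]
    exact (isMildSolutionCauchy_semigroup hA hdense v).norm_sub_euler_le hA.1 (eulerStep_pos n).le
      (hA.isEulerScheme_iterate (eulerStep_pos n) (k n) v) hz ht

theorem norm_semigroup_sub_le (hA : IsMAccretive A) (hdense : Dense (opDomain A))
    {t : ℝ} (ht : 0 ≤ t) (v w : V) : ‖semigroup A t v - semigroup A t w‖ ≤ ‖v - w‖ :=
  le_of_tendsto' ((tendsto_iterate_resolvent_semigroup hA hdense v ht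
    (tendsto_ceil_mul_eulerStep ht)).sub (tendsto_iterate_resolvent_semigroup hA hdense w ht
    (tendsto_ceil_mul_eulerStep ht))).norm
    fun n => hA.norm_iterate_resolvent_sub_le (eulerStep_pos n) _ v w

/-- The exponential formula allows any step counts whose elapsed time converges, so the sum of the
two ceilings serves for `s + t`; iterates of one resolvent compose exactly. -/
theorem semigroup_add (hA : IsMAccretive A) (hdense : Dense (opDomain A))
    {s t : ℝ} (hs : 0 ≤ s) (ht : 0 ≤ t) (v : V) :
    semigroup A (s + t) v = semigroup A s (semigroup A t v) := by
  have ps := tendsto_ceil_mul_eulerStep hs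
  have pt := tendsto_ceil_mul_eulerStep ht
  have l1 := tendsto_iterate_resolvent_semigroup hA hdense v (add_nonneg hs ht)
    (k := fun n => ⌈s / eulerStep n⌉₊ + ⌈t / eulerStep n⌉₊)
    ((ps.add pt).congr fun n => by push_cast; ring)
  have l2 := tendsto_iterate_resolvent_semigroup hA hdense v ht pt
  have l3 := tendsto_iterate_resolvent_semigroup hA hdense (semigroup A t v) hs ps
  have l4 : Tendsto (fun n => (resolvent A (eulerStep n))^[⌈s / eulerStep n⌉₊ + ⌈t / eulerStep n⌉₊] v
      - (resolvent A (eulerStep n))^[⌈s / eulerStep n⌉₊] (semigroup A t v)) atTop (𝓝 0) := by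
    refine squeeze_zero_norm (fun n => ?_) (tendsto_iff_norm_sub_tendsto_zero.1 l2)
    rw [Function.iterate_add_apply]
    exact hA.norm_iterate_resolvent_sub_le (eulerStep_pos n) _ _ _
  exact sub_eq_zero.1 (tendsto_nhds_unique (l1.sub l3) l4)

/-- Limit of the graph estimate for the scheme that starts at the graph point itself. -/
theorem norm_semigroup_sub_self_le (hA : IsMAccretive A) (hdense : Dense (opDomain A))
    {t : ℝ} (ht : 0 ≤ t) {v z : V} (hz : z ∈ A v) : ‖semigroup A t v - v‖ ≤ t * ‖z‖ := by
  have pt := tendsto_ceil_mul_eulerStep ht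
  refine le_of_tendsto_of_tendsto' ((tendsto_iterate_resolvent_semigroup hA hdense v ht
    pt).sub_const v).norm (pt.mul_const ‖z‖) fun n => ?_
  simpa using (hA.isEulerScheme_iterate (eulerStep_pos n) _ v).norm_sub_graph_le hA.1 hz le_rfl

theorem semigroup_apply_zero (hA : IsMAccretive A) (hdense : Dense (opDomain A))
    {t : ℝ} (ht : 0 ≤ t) (h0 : (0 : V) ∈ A 0) : semigroup A t 0 = 0 := by
  simpa using norm_semigroup_sub_self_le hA hdense ht h0

theorem continuousOn_semigroup (hA : IsMAccretive A) (hdense : Dense (opDomain A)) (v : V) :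
    ContinuousOn (fun t => semigroup A t v) (Ici 0) :=
  (isMildSolutionCauchy_semigroup hA hdense v).1

theorem continuous_semigroup_max (hA : IsMAccretive A) (hdense : Dense (opDomain A)) (v : V) :
    Continuous fun t : ℝ => semigroup A (max t 0) v :=
  (continuousOn_semigroup hA hdense v).comp_continuous (by fun_prop) fun t => le_max_right t 0

/-- Continuity in time and a Lipschitz constant in space uniform in time combine to joint
continuity, from which measurability of the generated process follows. -/
theorem continuous_semigroup_uncurry (hA : IsMAccretive A) (hdense : Dense (opDomain A)) :
    Continuous fun p : ℝ × V => semigroup A (max p.1 0) p.2 :=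
  continuous_prod_of_continuous_lipschitzWith' _ 1
    (fun t => LipschitzWith.of_dist_le_mul fun v w => by
      simpa [dist_eq_norm] using norm_semigroup_sub_le hA hdense (le_max_right t 0) v w)
    (continuous_semigroup_max hA hdense)

/-- Both values factor through the nonexpansive map `T(s - δ)`, which leaves the displacement of
`T(δ) v` during time `t - s`. -/
theorem norm_semigroup_sub_semigroup_le (hA : IsMAccretive A) (hdense : Dense (opDomain A))
    {δ s t : ℝ} (hδ : 0 ≤ δ) (hs : δ ≤ s) (hst : s ≤ t) {v z : V} (hz : z ∈ A (semigroup A δ v)) :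
    ‖semigroup A t v - semigroup A s v‖ ≤ (t - s) * ‖z‖ := by
  have e1 : semigroup A s v = semigroup A (s - δ) (semigroup A δ v) := by
    rw [← semigroup_add hA hdense (by linarith) hδ]; congr 1; ring
  have e2 : semigroup A t v =
      semigroup A (s - δ) (semigroup A (t - s) (semigroup A δ v)) := by
    rw [← semigroup_add hA hdense (by linarith) hδ, ← semigroup_add hA hdense (by linarith)
      (by linarith)]
    congr 1; ring
  rw [e1, e2]
  exact (norm_semigroup_sub_le hA hdense (by linarith) _ _).trans
    (norm_semigroup_sub_self_le hA hdense (by linarith) hz)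

/-- By the semigroup law, difference quotients at `t` are those at time `0` of the orbit started at
`T(t) v`, which lies in the domain. -/
theorem hasDerivWithinAt_semigroup (hA : IsMAccretive A) (hdense : Dense (opDomain A))
    (hdom : IsDomainInvariant A) (hG : IsInfinitesimalGenerator A G) (v : V) {t : ℝ} (ht : 0 < t) :
    HasDerivWithinAt (fun t => semigroup A t v) (-G (semigroup A t v)) (Ioi t) t := by
  rw [hasDerivWithinAt_iff_tendsto_slope' self_notMem_Ioi]
  have h1 := (hG.1 _ (hdom t ht v)).1.neg
  have h2 : Tendsto (fun s => s - t) (𝓝[>] t) (𝓝[>] 0) := by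
    refine tendsto_nhdsWithin_iff.2 ⟨?_, ?_⟩
    · have : Tendsto (fun s : ℝ => s - t) (𝓝 t) (𝓝 (t - t)) := Continuous.tendsto (by fun_prop) t
      rw [sub_self] at this
      exact this.mono_left nhdsWithin_le_nhds
    · filter_upwards [self_mem_nhdsWithin] with s hs using sub_pos.2 (mem_Ioi.1 hs)
  refine (h1.comp h2).congr' ?_
  filter_upwards [self_mem_nhdsWithin] with s hs
  have hs : t < s := hs
  simp only [Function.comp, neg_neg, slope, vsub_eq_sub]
  rw [← semigroup_add hA hdense (by linarith) ht.le, sub_add_cancel]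

/-- Lipschitz paths in a general Banach space need not be differentiable anywhere. Here the right
derivative exists everywhere, is measurable and bounded by `K`, so it integrates back to `f`, and
Lebesgue differentiation applies. -/
theorem ae_hasDerivAt_of_lipschitzOnWith {f f' : ℝ → V} {a b : ℝ} {K : NNReal} (hab : a ≤ b)
    (hf : LipschitzOnWith K f (Icc a b))
    (hd : ∀ t ∈ Ioo a b, HasDerivWithinAt f (f' t) (Ioi t) t) :
    ∀ᵐ t : ℝ, t ∈ Ioo a b → HasDerivAt f (f' t) t := by
  have hbound : ∀ t ∈ Ioo a b, ‖f' t‖ ≤ K := fun t ht => by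
    refine le_of_tendsto (((hasDerivWithinAt_iff_tendsto_slope' self_notMem_Ioi).1 (hd t ht)).norm) ?_
    filter_upwards [Ioo_mem_nhdsGT ht.2] with s hs
    rw [slope_def_module, norm_smul, norm_inv, Real.norm_eq_abs, inv_mul_le_iff₀
      (abs_pos.2 (sub_pos.2 hs.1).ne'), mul_comm]
    simpa [dist_eq_norm] using hf.dist_le_mul s ⟨ht.1.le.trans hs.1.le, hs.2.le⟩ t ⟨ht.1.le, ht.2.le⟩
  have hmeas : AEStronglyMeasurable f' (volume.restrict (Ioo a b)) := by
    refine (stronglyMeasurable_derivWithin_Ioi f).aestronglyMeasurable.congr ?_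
    filter_upwards [self_mem_ae_restrict measurableSet_Ioo] with t ht
    exact (hd t ht).derivWithin (uniqueDiffWithinAt_Ioi t)
  have hint : IntervalIntegrable f' volume a b := by
    rw [intervalIntegrable_iff_integrableOn_Ioo_of_le hab]
    exact IntegrableOn.of_bound measure_Ioo_lt_top hmeas K
      ((ae_restrict_iff' measurableSet_Ioo).2 (Eventually.of_forall hbound))
  filter_upwards [hint.ae_hasDerivAt_integral] with t h ht
  rw [uIcc_of_le hab] at h
  have h1 := (h (Ioo_subset_Icc_self ht) a (left_mem_Icc.2 hab)).const_add (f a)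
  refine h1.congr_of_eventuallyEq ?_
  filter_upwards [Ioo_mem_nhds ht.1 ht.2] with s hs
  have := intervalIntegral.integral_eq_sub_of_hasDeriv_right_of_le hs.1.le
    (hf.continuousOn.mono (Icc_subset_Icc_right hs.2.le))
    (fun x hx => hd x ⟨hx.1, hx.2.trans hs.2⟩)
    (hint.mono_set (by rw [uIcc_of_le hs.1.le, uIcc_of_le hab]; exact Icc_subset_Icc_right hs.2.le))
  rw [this]; abel

theorem lipschitzOnWith_semigroup (hA : IsMAccretive A) (hdense : Dense (opDomain A))
    {δ : ℝ} (hδ : 0 ≤ δ) {v z : V} (hz : z ∈ A (semigroup A δ v)) :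
    LipschitzOnWith ‖z‖₊ (fun t => semigroup A t v) (Ici δ) := by
  refine LipschitzOnWith.of_dist_le_mul fun s hs t ht => ?_
  wlog hst : s ≤ t generalizing s t
  · rw [dist_comm, dist_comm s]
    exact this t ht s hs (le_of_not_ge hst)
  rw [dist_comm, dist_comm s, dist_eq_norm, Real.dist_eq, abs_of_nonneg (sub_nonneg.2 hst), mul_comm]
  exact norm_semigroup_sub_semigroup_le hA hdense hδ hs hst hz

theorem ae_hasDerivAt_semigroup (hA : IsMAccretive A) (hdense : Dense (opDomain A))
    (hdom : IsDomainInvariant A) (hG : IsInfinitesimalGenerator A G) (v : V) :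
    ∀ᵐ t : ℝ, 0 < t → HasDerivAt (fun t => semigroup A t v) (-G (semigroup A t v)) t := by
  -- The half-line is exhausted by bounded intervals away from `0`, on each of which the orbit is
  -- Lipschitz.
  have key : ∀ n : ℕ, ∀ᵐ t : ℝ, t ∈ Ioo (eulerStep n) (n + 1) →
      HasDerivAt (fun t => semigroup A t v) (-G (semigroup A t v)) t := fun n => by
    have hle : eulerStep n ≤ n + 1 :=
      (div_le_one_of_le₀ (by linarith [n.cast_nonneg (α := ℝ)]) (by positivity)).trans
        (by linarith [n.cast_nonneg (α := ℝ)])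
    obtain ⟨z, hz⟩ := hdom _ (eulerStep_pos n) v
    exact ae_hasDerivAt_of_lipschitzOnWith hle
      ((lipschitzOnWith_semigroup hA hdense (eulerStep_pos n).le hz).mono Icc_subset_Ici_self)
      fun t ht => hasDerivWithinAt_semigroup hA hdense hdom hG v ((eulerStep_pos n).trans ht.1)
  filter_upwards [ae_all_iff.2 key] with t h ht
  obtain ⟨n, hn1, hn2⟩ := ((tendsto_eulerStep.eventually (gt_mem_nhds ht)).and
    (tendsto_natCast_atTop_atTop.eventually (eventually_gt_atTop t))).exists
  exact h n ⟨hn1, hn2.trans (lt_add_one _)⟩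

end Semigroup

/-! ### Enumeration of the points of a locally finite point function -/

namespace PointFunction

variable {Z : Type*} {θ : PointFunction Z}

/-- There are only finitely many points in every bounded time interval. -/
def IsLocallyFinite (θ : PointFunction Z) : Prop := ∀ t : ℝ, (θ.dom ∩ Iic t).Finite

theorem hittingTime_zero : θ.hittingTime 0 = 0 := rfl

theorem hittingTime_succ (m : ℕ) : θ.hittingTime (m + 1) =
    sInf {s | ∃ t ∈ θ.dom, s = ENNReal.ofReal t ∧ θ.hittingTime m < s} := rfl

theorem hittingTime_succ_le {m : ℕ} {t : ℝ} (ht : t ∈ θ.dom)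
    (h : θ.hittingTime m < ENNReal.ofReal t) : θ.hittingTime (m + 1) ≤ ENNReal.ofReal t :=
  sInf_le ⟨t, ht, rfl, h⟩

theorem monotone_hittingTime : Monotone θ.hittingTime :=
  monotone_nat_of_le_succ fun _ => le_sInf fun _ ⟨_, _, _, h⟩ => h.le

/-- Below any one candidate there are only finitely many others, so the infimum is attained. -/
theorem IsLocallyFinite.exists_hittingTime_succ (hθ : θ.IsLocallyFinite) {m : ℕ}
    (h : θ.hittingTime (m + 1) ≠ ∞) :
    ∃ t ∈ θ.dom, θ.hittingTime (m + 1) = ENNReal.ofReal t ∧ θ.hittingTime m < ENNReal.ofReal t := by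
  set S := {t | t ∈ θ.dom ∧ θ.hittingTime m < ENNReal.ofReal t} with hS
  have hne : S.Nonempty := by
    by_contra hne
    refine h ?_
    rw [hittingTime_succ, sInf_eq_top]
    rintro s ⟨t, ht, rfl, hs⟩
    exact absurd ⟨t, ht, hs⟩ hne
  obtain ⟨t₀, ht₀⟩ := hne
  obtain ⟨t, ⟨ht, htt⟩, hmin⟩ := ((hθ t₀).subset (t := S ∩ Iic t₀)
    fun s hs => ⟨hs.1.1, hs.2⟩).exists_minimalFor id _ ⟨t₀, ht₀, mem_Iic.2 le_rfl⟩
  refine ⟨t, ht.1, le_antisymm (hittingTime_succ_le ht.1 ht.2) (le_sInf ?_), ht.2⟩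
  rintro _ ⟨s, hs, rfl, hs'⟩
  refine ENNReal.ofReal_le_ofReal ?_
  rcases le_total s t₀ with hst | hst
  · by_contra hlt
    exact hlt (hmin ⟨⟨hs, hs'⟩, hst⟩ (not_le.1 hlt).le)
  · exact (mem_Iic.1 htt).trans hst

theorem IsLocallyFinite.hittingTime_lt_succ (hθ : θ.IsLocallyFinite) {m : ℕ}
    (h : θ.hittingTime m ≠ ∞) : θ.hittingTime m < θ.hittingTime (m + 1) := by
  by_cases h' : θ.hittingTime (m + 1) = ∞
  · rw [h']; exact h.lt_top
  · obtain ⟨t, -, e, h2⟩ := hθ.exists_hittingTime_succ h'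
    rwa [e]

theorem IsLocallyFinite.hittingTime_lt (hθ : θ.IsLocallyFinite) {m n : ℕ} (hmn : m < n)
    (h : θ.hittingTime m ≠ ∞) : θ.hittingTime m < θ.hittingTime n :=
  (hθ.hittingTime_lt_succ h).trans_le (monotone_hittingTime hmn)

theorem IsLocallyFinite.toReal_hittingTime_mem (hθ : θ.IsLocallyFinite) {m : ℕ}
    (h : θ.hittingTime (m + 1) ≠ ∞) : (θ.hittingTime (m + 1)).toReal ∈ θ.dom := by
  obtain ⟨t, ht, e, -⟩ := hθ.exists_hittingTime_succ h
  rwa [e, ENNReal.toReal_ofReal (θ.dom_pos ht).le]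

theorem toReal_hittingTime_mem_iff (hθ : θ.IsLocallyFinite) {m : ℕ} :
    (θ.hittingTime (m + 1)).toReal ∈ θ.dom ↔ θ.hittingTime (m + 1) ≠ ∞ := by
  refine ⟨fun h h' => ?_, hθ.toReal_hittingTime_mem⟩
  rw [h'] at h
  exact lt_irrefl _ (mem_Ioi.1 (θ.dom_pos h))

theorem IsLocallyFinite.exists_lt_hittingTime (hθ : θ.IsLocallyFinite) (t : ℝ) :
    ∃ m, ENNReal.ofReal t < θ.hittingTime m := by
  by_contra! hall
  have hfin : ∀ m, θ.hittingTime m ≠ ∞ := fun m => ((hall m).trans_lt ENNReal.ofReal_lt_top).ne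
  -- If all hitting times stayed below `t`, they would be infinitely many distinct points in a
  -- bounded interval.
  refine (infinite_of_injective_forall_mem (f := fun m => (θ.hittingTime (m + 1)).toReal)
    (fun a b hab => ?_) fun m => ?_) (hθ (max t 0))
  · have e := (ENNReal.toReal_eq_toReal_iff' (hfin _) (hfin _)).1 hab
    rcases lt_trichotomy a b with h | h | h
    · exact absurd e (hθ.hittingTime_lt (by omega) (hfin _)).ne
    · exact h
    · exact absurd e (hθ.hittingTime_lt (by omega) (hfin _)).ne'
  · refine ⟨hθ.toReal_hittingTime_mem (hfin _), ?_⟩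
    have := ENNReal.toReal_mono ENNReal.ofReal_ne_top (hall (m + 1))
    rwa [ENNReal.toReal_ofReal'] at this

theorem IsLocallyFinite.exists_mem_Ico (hθ : θ.IsLocallyFinite) (t : ℝ) :
    ∃ m, ENNReal.ofReal t ∈ Ico (θ.hittingTime m) (θ.hittingTime (m + 1)) := by
  classical
  have hex := hθ.exists_lt_hittingTime t
  obtain ⟨m, hm⟩ : ∃ m, Nat.find hex = m + 1 := Nat.exists_eq_succ_of_ne_zero fun h => by
    have := Nat.find_spec hex
    rw [h] at this
    exact not_lt_bot this
  exact ⟨m, not_lt.1 (Nat.find_min hex (by omega)), hm ▸ Nat.find_spec hex⟩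

theorem eq_of_mem_Ico_hittingTime {m n : ℕ} {s : ℝ≥0∞}
    (hm : s ∈ Ico (θ.hittingTime m) (θ.hittingTime (m + 1)))
    (hn : s ∈ Ico (θ.hittingTime n) (θ.hittingTime (n + 1))) : m = n := by
  rcases lt_trichotomy m n with h | h | h
  · exact absurd (hm.2.trans_le (monotone_hittingTime h)) (not_lt.2 hn.1)
  · exact h
  · exact absurd (hn.2.trans_le (monotone_hittingTime h)) (not_lt.2 hm.1)

theorem IsLocallyFinite.exists_eq_hittingTime (hθ : θ.IsLocallyFinite) {s : ℝ} (hs : s ∈ θ.dom) :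
    ∃ m, θ.hittingTime (m + 1) = ENNReal.ofReal s := by
  obtain ⟨m, h1, h2⟩ := hθ.exists_mem_Ico s
  rcases h1.eq_or_lt with e | h1
  · cases m with
    | zero =>
      rw [hittingTime_zero, eq_comm, ENNReal.ofReal_eq_zero] at e
      exact absurd (θ.dom_pos hs) (not_lt.2 e)
    | succ m => exact ⟨m, e⟩
  · exact absurd h2 (not_lt.2 (hittingTime_succ_le hs h1))

/-- The Dirac measure at the point of `θ` at time `s`, and `0` if there is no such point. -/
noncomputable def diracAt [MeasurableSpace Z] (θ : PointFunction Z) (s : ℝ) : Measure (ℝ × Z) :=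
  open Classical in if h : s ∈ θ.dom then Measure.dirac (s, θ.toFun ⟨s, h⟩) else 0

/-- Up to a time in `[α_m, α_{m+1})` the points are exactly `α_1, …, α_m`; this turns every integral
against the counting measure into a finite sum. -/
theorem IsLocallyFinite.restrict_countingMeasure [MeasurableSpace Z] (hθ : θ.IsLocallyFinite)
    {m : ℕ} {t : ℝ}
    (ht : ENNReal.ofReal t ∈ Ico (θ.hittingTime m) (θ.hittingTime (m + 1))) :
    θ.countingMeasure.restrict (Ioc 0 t ×ˢ univ) =
      ∑ k ∈ Finset.range m, θ.diracAt (θ.hittingTime (k + 1)).toReal := by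
  classical
  have hfin : ∀ k ∈ Finset.range m, θ.hittingTime (k + 1) ≤ ENNReal.ofReal t := fun k hk =>
    (monotone_hittingTime (Finset.mem_range.1 hk)).trans ht.1
  have hdom : ∀ k ∈ Finset.range m, (θ.hittingTime (k + 1)).toReal ∈ θ.dom := fun k hk =>
    hθ.toReal_hittingTime_mem ((hfin k hk).trans_lt ENNReal.ofReal_lt_top).ne
  ext U hU
  rw [Measure.restrict_apply hU, countingMeasure,
    Measure.sum_apply _ (hU.inter (measurableSet_Ioc.prod MeasurableSet.univ)),
    Measure.finsetSum_apply]
  rw [tsum_eq_sum (s := (Finset.range m).attach.image fun k => ⟨_, hdom k.1 k.2⟩),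
    Finset.sum_image, ← Finset.sum_attach (Finset.range m)]
  · refine Finset.sum_congr rfl fun k _ => ?_
    rw [diracAt, dif_pos (hdom k.1 k.2), Measure.dirac_apply' _ hU,
      Measure.dirac_apply' _ (hU.inter (measurableSet_Ioc.prod MeasurableSet.univ))]
    have hmem : (θ.hittingTime (k.1 + 1)).toReal ∈ Ioc 0 t := by
      refine ⟨θ.dom_pos (hdom k.1 k.2), ?_⟩
      have h1 := hfin k.1 k.2
      have h2 : 0 < t := by
        by_contra h0
        rw [ENNReal.ofReal_of_nonpos (not_lt.1 h0), nonpos_iff_eq_zero] at h1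
        have := θ.dom_pos (hdom k.1 k.2)
        rw [h1] at this
        exact lt_irrefl _ (mem_Ioi.1 this)
      exact ENNReal.toReal_le_of_le_ofReal h2.le h1
    simp only [Set.indicator, mem_inter_iff, mem_prod, hmem, mem_univ, and_self, and_true]
  · intro a _ b _ hab
    have ha := (hfin a.1 a.2).trans_lt ENNReal.ofReal_lt_top
    have hb := (hfin b.1 b.2).trans_lt ENNReal.ofReal_lt_top
    have e : (θ.hittingTime (a.1 + 1)).toReal = (θ.hittingTime (b.1 + 1)).toReal :=
      Subtype.mk.inj hab
    rw [ENNReal.toReal_eq_toReal_iff' ha.ne hb.ne] at e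
    refine Subtype.ext ?_
    rcases lt_trichotomy a.1 b.1 with h | h | h
    · exact absurd e (hθ.hittingTime_lt (by omega) ha.ne).ne
    · exact h
    · exact absurd e (hθ.hittingTime_lt (by omega) hb.ne).ne'
  · intro s hs
    rw [Measure.dirac_apply' _ (hU.inter (measurableSet_Ioc.prod MeasurableSet.univ))]
    refine indicator_of_notMem (fun hmem => hs ?_) _
    have hst : (s : ℝ) ∈ Ioc 0 t := hmem.2.1
    obtain ⟨k, hk⟩ := hθ.exists_eq_hittingTime s.2
    have hkm : k < m := by
      by_contra hkm
      refine absurd (ht.2.trans_le (monotone_hittingTime (show m + 1 ≤ k + 1 by omega))) ?_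
      rw [hk, not_lt]
      exact ENNReal.ofReal_le_ofReal hst.2
    refine Finset.mem_image.2 ⟨⟨k, Finset.mem_range.2 hkm⟩, Finset.mem_attach _ _, ?_⟩
    refine Subtype.ext ?_
    simp only [hk]
    exact ENNReal.toReal_ofReal hst.1.le

/-! ### Integrals against the counting measure -/

section Integrals

variable [MeasurableSpace Z]

open Classical in
/-- The value of `f` at the point of `θ` at time `s`, and `0` if there is no such point. -/
noncomputable def evalAt {E : Type*} [Zero E] (θ : PointFunction Z) (f : ℝ × Z → E) (s : ℝ) : E :=
  if h : s ∈ θ.dom then f (s, θ.toFun ⟨s, h⟩) else 0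

theorem lintegral_diracAt (s : ℝ) {f : ℝ × Z → ℝ≥0∞} (hf : Measurable f) :
    ∫⁻ p, f p ∂θ.diracAt s = θ.evalAt f s := by
  unfold diracAt evalAt
  split_ifs
  · exact lintegral_dirac' _ hf
  · simp

theorem integral_diracAt {E : Type*} [NormedAddCommGroup E] [NormedSpace ℝ E] [CompleteSpace E]
    (s : ℝ) {f : ℝ × Z → E} (hf : StronglyMeasurable f) :
    ∫ p, f p ∂θ.diracAt s = θ.evalAt f s := by
  unfold diracAt evalAt
  split_ifs
  · exact integral_dirac' _ _ hf
  · simp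

theorem integrable_diracAt {E : Type*} [NormedAddCommGroup E]
    (s : ℝ) {f : ℝ × Z → E} (hf : StronglyMeasurable f) : Integrable f (θ.diracAt s) := by
  unfold diracAt
  split_ifs
  · exact integrable_dirac' hf enorm_lt_top
  · simp

variable {m : ℕ} {t : ℝ}

/-- Measurability is asked only of the restriction to positive times, since that is all the
measurability of `η` provides. -/
theorem IsLocallyFinite.setLIntegral_countingMeasure (hθ : θ.IsLocallyFinite)
    (ht : ENNReal.ofReal t ∈ Ico (θ.hittingTime m) (θ.hittingTime (m + 1)))
    {f : ℝ × Z → ℝ≥0∞} (hf : Measurable ((Ioi 0 ×ˢ univ : Set (ℝ × Z)).indicator f)) :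
    ∫⁻ p in Ioc 0 t ×ˢ univ, f p ∂θ.countingMeasure =
      ∑ k ∈ Finset.range m, θ.evalAt f (θ.hittingTime (k + 1)).toReal := by
  rw [setLIntegral_congr_fun (g := (Ioi 0 ×ˢ univ : Set (ℝ × Z)).indicator f)
    (measurableSet_Ioc.prod MeasurableSet.univ)
    (fun p hp => (indicator_of_mem (s := (Ioi 0 ×ˢ univ : Set (ℝ × Z)))
      ⟨hp.1.1, mem_univ _⟩ f).symm), hθ.restrict_countingMeasure ht, lintegral_finsetSum_measure]
  refine Finset.sum_congr rfl fun k _ => ?_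
  rw [lintegral_diracAt _ hf]
  unfold evalAt
  split_ifs with h
  · exact indicator_of_mem (s := (Ioi 0 ×ˢ univ : Set (ℝ × Z))) ⟨θ.dom_pos h, mem_univ _⟩ f
  · rfl

theorem IsLocallyFinite.integrableOn_countingMeasure (hθ : θ.IsLocallyFinite) (t : ℝ)
    {E : Type*} [NormedAddCommGroup E] {f : ℝ × Z → E}
    (hf : StronglyMeasurable ((Ioi 0 ×ˢ univ : Set (ℝ × Z)).indicator f)) :
    IntegrableOn f (Ioc 0 t ×ˢ univ) θ.countingMeasure := by
  obtain ⟨m, ht⟩ := hθ.exists_mem_Ico t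
  refine IntegrableOn.congr_fun (f := (Ioi 0 ×ˢ univ : Set (ℝ × Z)).indicator f) ?_
    (fun p hp => indicator_of_mem (s := (Ioi 0 ×ˢ univ : Set (ℝ × Z))) ⟨hp.1.1, mem_univ _⟩ f)
    (measurableSet_Ioc.prod MeasurableSet.univ)
  rw [IntegrableOn, hθ.restrict_countingMeasure ht, integrable_finsetSum_measure]
  exact fun k _ => integrable_diracAt _ hf

theorem IsLocallyFinite.setIntegral_countingMeasure (hθ : θ.IsLocallyFinite)
    (ht : ENNReal.ofReal t ∈ Ico (θ.hittingTime m) (θ.hittingTime (m + 1)))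
    {E : Type*} [NormedAddCommGroup E] [NormedSpace ℝ E] [CompleteSpace E] {f : ℝ × Z → E}
    (hf : StronglyMeasurable ((Ioi 0 ×ˢ univ : Set (ℝ × Z)).indicator f)) :
    ∫ p in Ioc 0 t ×ˢ univ, f p ∂θ.countingMeasure =
      ∑ k ∈ Finset.range m, θ.evalAt f (θ.hittingTime (k + 1)).toReal := by
  rw [setIntegral_congr_fun (g := (Ioi 0 ×ˢ univ : Set (ℝ × Z)).indicator f)
    (measurableSet_Ioc.prod MeasurableSet.univ)
    (fun p hp => (indicator_of_mem (s := (Ioi 0 ×ˢ univ : Set (ℝ × Z)))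
      ⟨hp.1.1, mem_univ _⟩ f).symm), hθ.restrict_countingMeasure ht,
    integral_finsetSum_measure fun k _ => integrable_diracAt _ hf]
  refine Finset.sum_congr rfl fun k _ => ?_
  rw [integral_diracAt _ hf]
  unfold evalAt
  split_ifs with h
  · exact indicator_of_mem (s := (Ioi 0 ×ˢ univ : Set (ℝ × Z))) ⟨θ.dom_pos h, mem_univ _⟩ f
  · rfl

end Integrals

end PointFunction

/-! ### Almost sure local finiteness; measurability of hitting times and marks -/

section Measurability

variable {Ω Z V : Type*} [MeasurableSpace Ω] [MeasurableSpace Z] {P : Measure Ω}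
  {Θ : Ω → PointFunction Z}

theorem PointFunction.measurable_numPoints {U : Set (ℝ × Z)} (hU : MeasurableSet U)
    (hU0 : U ⊆ Ioi 0 ×ˢ univ) : Measurable fun θ : PointFunction Z => θ.numPoints U := by
  have hk : ∀ k : ℕ, MeasurableSet {θ : PointFunction Z | θ.numPoints U = k} := fun k =>
    MeasurableSpace.measurableSet_generateFrom ⟨k, U, hU, hU0, rfl⟩
  refine measurable_to_countable' fun n => ?_
  induction n using ENat.recTopCoe with
  | coe k => exact hk k
  | top =>
    have : (fun θ : PointFunction Z => θ.numPoints U) ⁻¹' {⊤} =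
        (⋃ k : ℕ, {θ : PointFunction Z | θ.numPoints U = k})ᶜ := by
      ext θ
      simp only [mem_preimage, mem_singleton_iff, mem_compl_iff, mem_iUnion, mem_ofPred_eq,
        not_exists]
      exact ⟨fun h k => by simp [h], fun h => by
        by_contra h'
        obtain ⟨k, hk⟩ := ENat.ne_top_iff_exists.1 h'
        exact h k hk.symm⟩
    rw [this]
    exact (MeasurableSet.iUnion hk).compl

/-- A count with finite expectation is a.s. finite, and the intervals `(0, n + 1]` are countably
many. -/
theorem IsFinitePP.ae_isLocallyFinite (hΘ : IsFinitePP P Θ) :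
    ∀ᵐ ω ∂P, (Θ ω).IsLocallyFinite := by
  have hmeas : ∀ n : ℕ, MeasurableSet (Ioc (0 : ℝ) (n + 1) ×ˢ (univ : Set Z)) := fun n =>
    measurableSet_Ioc.prod MeasurableSet.univ
  have key : ∀ n : ℕ, ∀ᵐ ω ∂P, (Θ ω).numPoints (Ioc (0 : ℝ) (n + 1) ×ˢ univ) ≠ ⊤ := by
    intro n
    have h1 := hΘ.2 (n + 1) (by positivity)
    simp only [PointFunction.countingMeasure_apply _ (hmeas n)] at h1
    have h2 : Measurable fun ω => (((Θ ω).numPoints (Ioc (0 : ℝ) (n + 1) ×ˢ univ) : ℕ∞) : ℝ≥0∞) :=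
      (Measurable.of_discrete (f := fun n : ℕ∞ => (n : ℝ≥0∞))).comp
        ((PointFunction.measurable_numPoints (hmeas n)
          (prod_mono_left Ioc_subset_Ioi_self)).comp hΘ.1)
    filter_upwards [ae_lt_top h2 h1.ne] with ω hω h
    rw [h] at hω
    simp at hω
  filter_upwards [ae_all_iff.2 key] with ω h t
  obtain ⟨n, hn⟩ := exists_nat_ge t
  have hfin := encard_ne_top_iff.1 (h n)
  refine (hfin.image Subtype.val).subset fun s hs => ⟨⟨s, hs.1⟩, ?_, rfl⟩
  exact ⟨⟨(Θ ω).dom_pos hs.1, by linarith [mem_Iic.1 hs.2]⟩, mem_univ _⟩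

/-- Completeness of `P` enters here: descriptions valid only on locally finite paths still yield
measurability. -/
theorem measurable_of_ae_eq_sets [P.IsComplete] {s t : Set Ω} (ht : MeasurableSet t)
    (h : ∀ᵐ ω ∂P, ω ∈ s ↔ ω ∈ t) : MeasurableSet s :=
  (ht.nullMeasurableSet.congr (eventuallyEq_set.2 (h.mono fun _ => Iff.symm))).measurable_of_complete

/-- For `t` in `[α_j, α_{j+1})` the count is exactly `j`, read off by integrating the constant `1`.
This expresses hitting times through the generators of the σ-algebra. -/
theorem PointFunction.IsLocallyFinite.hittingTime_le_iff {θ : PointFunction Z}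
    (hθ : θ.IsLocallyFinite) (m : ℕ) (t : ℝ) :
    θ.hittingTime m ≤ ENNReal.ofReal t ↔ (m : ℕ∞) ≤ θ.numPoints (Ioc 0 t ×ˢ univ) := by
  obtain ⟨j, hj⟩ := hθ.exists_mem_Ico t
  have e := θ.countingMeasure_apply (measurableSet_Ioc.prod MeasurableSet.univ : MeasurableSet
    (Ioc (0 : ℝ) t ×ˢ (univ : Set Z)))
  rw [← setLIntegral_one, hθ.setLIntegral_countingMeasure hj
    (measurable_const.indicator (measurableSet_Ioi.prod MeasurableSet.univ))] at e
  have e2 : ∑ k ∈ Finset.range j, θ.evalAt (fun _ => (1 : ℝ≥0∞)) (θ.hittingTime (k + 1)).toReal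
      = ((j : ℕ∞) : ℝ≥0∞) := by
    rw [Finset.sum_congr rfl (g := fun _ => 1)]
    · simp
    · intro k hk
      rw [evalAt, dif_pos]
      exact hθ.toReal_hittingTime_mem (((monotone_hittingTime (Finset.mem_range.1 hk)).trans
        hj.1).trans_lt ENNReal.ofReal_lt_top).ne
  rw [e2] at e
  rw [← ENat.toENNReal_inj.1 e, Nat.cast_le]
  refine ⟨fun h => ?_, fun h => (monotone_hittingTime h).trans hj.1⟩
  by_contra hlt
  exact absurd (hj.2.trans_le (monotone_hittingTime (not_le.1 hlt))) (not_lt.2 h)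

theorem IsFinitePP.measurable_hittingTime [P.IsComplete] (hΘ : IsFinitePP P Θ) (m : ℕ) :
    Measurable fun ω => (Θ ω).hittingTime m := by
  refine measurable_of_Iic fun c => ?_
  induction c using ENNReal.recTopCoe with
  | top => simp
  | coe c =>
    refine measurable_of_ae_eq_sets (P := P)
      (t := {ω | (m : ℕ∞) ≤ (Θ ω).numPoints (Ioc 0 (c : ℝ) ×ˢ univ)}) ?_ ?_
    · exact ((PointFunction.measurable_numPoints (measurableSet_Ioc.prod MeasurableSet.univ)
        (prod_mono_left Ioc_subset_Ioi_self)).comp hΘ.1) (MeasurableSet.of_discrete (s := Ici (m : ℕ∞)))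
    · filter_upwards [hΘ.ae_isLocallyFinite] with ω hω
      have := hω.hittingTime_le_iff m c
      rwa [ENNReal.ofReal_coe_nnreal] at this

theorem exists_rat_ofReal_between {a b : ℝ≥0∞} (h : a < b) :
    ∃ q : ℚ, 0 ≤ (q : ℝ) ∧ a < ENNReal.ofReal q ∧ ENNReal.ofReal q < b := by
  obtain ⟨q, h0, h1, h2⟩ := ENNReal.lt_iff_exists_rat_btwn.1 h
  exact ⟨q, by exact_mod_cast h0, h1, h2⟩

/-- Rationals with `α_m ≤ p < α_{m+1} ≤ q < α_{m+2}` isolate the `(m+1)`-st point in `(p, q]`, so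
its mark lies in `C` exactly when `(p, q] × C` contains a point. -/
theorem IsFinitePP.measurableSet_mark_mem [P.IsComplete] (hΘ : IsFinitePP P Θ) (m : ℕ)
    {C : Set Z} (hC : MeasurableSet C) :
    MeasurableSet {ω | ∃ h : ((Θ ω).hittingTime (m + 1)).toReal ∈ (Θ ω).dom,
      (Θ ω).toFun ⟨_, h⟩ ∈ C} := by
  have hm := hΘ.measurable_hittingTime
  refine measurable_of_ae_eq_sets (P := P) (t := ⋃ (p : ℚ) (q : ℚ) (_ : 0 ≤ (p : ℝ)),
    {ω | (Θ ω).hittingTime m ≤ ENNReal.ofReal p} ∩ {ω | ENNReal.ofReal p < (Θ ω).hittingTime (m + 1)} ∩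
    {ω | (Θ ω).hittingTime (m + 1) ≤ ENNReal.ofReal q} ∩
    {ω | ENNReal.ofReal q < (Θ ω).hittingTime (m + 2)} ∩
    {ω | (Θ ω).numPoints (Ioc (p : ℝ) q ×ˢ C) ≠ 0}) ?_ ?_
  · refine MeasurableSet.iUnion fun p => MeasurableSet.iUnion fun q => MeasurableSet.iUnion fun hp =>
      ((((measurableSet_le (hm _) measurable_const).inter
      (measurableSet_lt measurable_const (hm _))).inter
      (measurableSet_le (hm _) measurable_const)).inter
      (measurableSet_lt measurable_const (hm _))).inter ?_
    exact ((PointFunction.measurable_numPoints (measurableSet_Ioc.prod hC)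
        (prod_mono (fun x hx => hp.trans_lt hx.1) (subset_univ _))).comp hΘ.1)
        (MeasurableSet.of_discrete (s := {(0 : ℕ∞)}ᶜ))
  · filter_upwards [hΘ.ae_isLocallyFinite] with ω hω
    simp only [mem_iUnion, mem_inter_iff, mem_ofPred_eq, PointFunction.numPoints, ne_eq,
      encard_eq_zero, ← nonempty_iff_ne_empty]
    constructor
    · rintro ⟨h, hz⟩
      have hfin := (PointFunction.toReal_hittingTime_mem_iff hω).1 h
      obtain ⟨p, hp0, hp1, hp2⟩ := exists_rat_ofReal_between (hω.hittingTime_lt m.lt_succ_self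
        ((PointFunction.monotone_hittingTime m.le_succ).trans_lt hfin.lt_top).ne)
      obtain ⟨q, hq0, hq1, hq2⟩ := exists_rat_ofReal_between
        (hω.hittingTime_lt (m + 1).lt_succ_self hfin)
      refine ⟨p, q, hp0, ⟨⟨⟨hp1.le, hp2⟩, hq1.le⟩, hq2⟩, ⟨_, h⟩, ⟨?_, ?_⟩, hz⟩
      · exact (ENNReal.ofReal_lt_iff_lt_toReal hp0 hfin).1 hp2
      · exact ENNReal.toReal_le_of_le_ofReal hq0 hq1.le
    · rintro ⟨p, q, hp0, ⟨⟨⟨h1, h2⟩, h3⟩, h4⟩, ⟨s, hs⟩, ⟨hs1, hs2⟩, hsC⟩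
      obtain ⟨k, hk⟩ := hω.exists_eq_hittingTime hs
      have hs0 : 0 < s := hp0.trans_lt hs1
      have hle : (Θ ω).hittingTime m < ENNReal.ofReal s :=
        h1.trans_lt ((ENNReal.ofReal_lt_ofReal_iff hs0).2 hs1)
      have hlt : ENNReal.ofReal s < (Θ ω).hittingTime (m + 2) :=
        (ENNReal.ofReal_le_ofReal hs2).trans_lt h4
      have hkm : k = m := by
        rw [← hk] at hle hlt
        have := PointFunction.monotone_hittingTime.reflect_lt hle
        have := PointFunction.monotone_hittingTime.reflect_lt hlt
        omega
      subst hkm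
      have e : ((Θ ω).hittingTime (k + 1)).toReal = s := by
        rw [hk, ENNReal.toReal_ofReal hs0.le]
      have hmem : ((Θ ω).hittingTime (k + 1)).toReal ∈ (Θ ω).dom := e ▸ hs
      refine ⟨hmem, ?_⟩
      have : (⟨_, hmem⟩ : (Θ ω).dom) = ⟨s, hs⟩ := Subtype.ext e
      rw [this]
      exact hsC

variable [NormedAddCommGroup V] [MeasurableSpace V]

theorem IsFinitePP.measurable_jumpSize [P.IsComplete] (hΘ : IsFinitePP P Θ) {η : ℝ → Z → Ω → V}
    (hη : IsMeasurableDrift η) (m : ℕ) : Measurable (jumpSize Θ η (m + 1)) := by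
  classical
  set S : Set Ω := {ω | ((Θ ω).hittingTime (m + 1)).toReal ∈ (Θ ω).dom} with hS
  have hSm : MeasurableSet S := by
    simpa only [mem_univ, exists_prop, and_true] using
      hΘ.measurableSet_mark_mem m (MeasurableSet.univ (α := Z))
  have hmark : Measurable fun ω : S => (Θ ω).toFun ⟨_, ω.2⟩ := by
    intro C hC
    refine ⟨_, hΘ.measurableSet_mark_mem m hC, ?_⟩
    ext ω
    exact ⟨fun ⟨_, h⟩ => h, fun h => ⟨ω.2, h⟩⟩
  have htime : Measurable fun ω : S => (⟨((Θ ω).hittingTime (m + 1)).toReal,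
      (Θ ω).dom_pos ω.2⟩ : Ioi (0 : ℝ)) :=
    ((hΘ.measurable_hittingTime (m + 1)).ennreal_toReal.comp measurable_subtype_coe).subtype_mk
  exact Measurable.dite (s := S) (hη.comp (htime.prodMk (hmark.prodMk measurable_subtype_coe)))
    (measurable_const (a := (0 : V))) hSm

end Measurability

/-! ### Measurability of the generated process -/

section GeneratedSol

variable {Ω Z V : Type*} {Θ : Ω → PointFunction Z} [NormedAddCommGroup V] [NormedSpace ℝ V]
  {A : V → Set V}

/-- The value of the generated process on `[α_m, α_{m+1})`. -/
theorem generatedSol_eq (A : V → Set V) (Θ : Ω → PointFunction Z) (x : Ω → V)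
    (η : ℝ → Z → Ω → V) {t : ℝ} {ω : Ω} {m : ℕ}
    (ht : ENNReal.ofReal t ∈ Ico ((Θ ω).hittingTime m) ((Θ ω).hittingTime (m + 1))) :
    generatedSol A Θ x η t ω =
      semigroup A (max (t - ((Θ ω).hittingTime m).toReal) 0) (jumpSequence A Θ x η m ω) := by
  rw [generatedSol, tsum_eq_single m, indicator_of_mem ht]
  intro n hn
  exact indicator_of_notMem (fun h => hn (PointFunction.eq_of_mem_Ico_hittingTime h ht)) _

theorem summable_generatedSol (A : V → Set V) (Θ : Ω → PointFunction Z) (x : Ω → V)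
    (η : ℝ → Z → Ω → V) (t : ℝ) (ω : Ω) :
    Summable fun m : ℕ => (Ico ((Θ ω).hittingTime m) ((Θ ω).hittingTime (m + 1))).indicator
      (fun _ => semigroup A (max (t - ((Θ ω).hittingTime m).toReal) 0) (jumpSequence A Θ x η m ω))
      (ENNReal.ofReal t) := by
  refine summable_of_hasFiniteSupport (Set.Subsingleton.finite fun m hm n hn => ?_)
  exact PointFunction.eq_of_mem_Ico_hittingTime (mem_of_indicator_ne_zero hm)
    (mem_of_indicator_ne_zero hn)

variable [MeasurableSpace Ω] [MeasurableSpace Z] {P : Measure Ω}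
  [CompleteSpace V] [TopologicalSpace.SeparableSpace V] [MeasurableSpace V] [BorelSpace V]

theorem measurable_semigroup_comp (hA : IsMAccretive A) (hdense : Dense (opDomain A))
    {α : Type*} [MeasurableSpace α] {f : α → ℝ} {g : α → V} (hf : Measurable f)
    (hg : Measurable g) : Measurable fun a => semigroup A (max (f a) 0) (g a) := by
  have := UniformSpace.secondCountable_of_separable V
  exact (continuous_semigroup_uncurry hA hdense).measurable.comp (hf.prodMk hg)

theorem IsFinitePP.measurable_jumpSequence [P.IsComplete] (hΘ : IsFinitePP P Θ)
    (hA : IsMAccretive A) (hdense : Dense (opDomain A)) {x : Ω → V} (hx : Measurable x)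
    {η : ℝ → Z → Ω → V} (hη : IsMeasurableDrift η) (m : ℕ) :
    Measurable (jumpSequence A Θ x η m) := by
  have := UniformSpace.secondCountable_of_separable V
  induction m with
  | zero => exact hx
  | succ m ih =>
    have h1 : Measurable fun ω =>
        ((Θ ω).hittingTime (m + 1) - (Θ ω).hittingTime m).toReal :=
      ((hΘ.measurable_hittingTime _).sub (hΘ.measurable_hittingTime _)).ennreal_toReal
    have h2 := measurable_semigroup_comp hA hdense h1 ih
    simp only [max_eq_left ENNReal.toReal_nonneg] at h2
    exact h2.add (hΘ.measurable_jumpSize hη m)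

theorem IsFinitePP.isJointlyMeasurable_generatedSol [P.IsComplete] (hΘ : IsFinitePP P Θ)
    (hA : IsMAccretive A) (hdense : Dense (opDomain A)) {x : Ω → V} (hx : Measurable x)
    {η : ℝ → Z → Ω → V} (hη : IsMeasurableDrift η) :
    IsJointlyMeasurable (generatedSol A Θ x η) := by
  classical
  have := UniformSpace.secondCountable_of_separable V
  have ht : Measurable fun p : Ici (0 : ℝ) × Ω => (p.1 : ℝ) :=
    measurable_subtype_coe.comp measurable_fst
  have hα : ∀ m, Measurable fun p : Ici (0 : ℝ) × Ω => (Θ p.2).hittingTime m := fun m =>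
    (hΘ.measurable_hittingTime m).comp measurable_snd
  set F : ℕ → Ici (0 : ℝ) × Ω → V := fun m p =>
    (Ico ((Θ p.2).hittingTime m) ((Θ p.2).hittingTime (m + 1))).indicator
      (fun _ => semigroup A (max (p.1 - ((Θ p.2).hittingTime m).toReal) 0)
        (jumpSequence A Θ x η m p.2)) (ENNReal.ofReal p.1) with hF
  have hFm : ∀ m, Measurable (F m) := fun m => by
    simp only [hF, Set.indicator]
    refine Measurable.ite ?_ ?_ measurable_const
    · exact (measurableSet_le (hα m) ht.ennreal_ofReal).inter
        (measurableSet_lt ht.ennreal_ofReal (hα (m + 1)))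
    · exact measurable_semigroup_comp hA hdense (ht.sub (hα m).ennreal_toReal)
        ((hΘ.measurable_jumpSequence hA hdense hx hη m).comp measurable_snd)
  have hlim : Tendsto (fun n p => ∑ m ∈ Finset.range n, F m p) atTop
      (𝓝 fun p : Ici (0 : ℝ) × Ω => generatedSol A Θ x η p.1 p.2) :=
    tendsto_pi_nhds.2 fun p => (summable_generatedSol A Θ x η p.1 p.2).hasSum.tendsto_sum_nat
  exact measurable_of_tendsto_metrizable (fun n => Finset.measurable_fun_sum _ fun m _ => hFm m) hlim

end GeneratedSol

theorem absolutelyContinuousOnInterval_norm {V : Type*} [NormedAddCommGroup V] {f : ℝ → V} {a b : ℝ}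
    (hf : AbsolutelyContinuousOnInterval f a b) :
    AbsolutelyContinuousOnInterval (fun t => ‖f t‖) a b :=
  squeeze_zero (fun _ => Finset.sum_nonneg fun _ _ => dist_nonneg)
    (fun _ => Finset.sum_le_sum fun _ _ => by
      simpa only [dist_eq_norm] using dist_norm_norm_le _ _)
    (by simpa only [AbsolutelyContinuousOnInterval, dist_eq_norm] using hf)

/-! ### Dissipative paths and uniqueness between jumps -/

section Dissipative

variable {V : Type*} [NormedAddCommGroup V] [NormedSpace ℝ V] {A : V → Set V} {G : V → V}

/-- With `h = t - s`, the vector `f t - h • f'` is the first-order prediction of `f s`, so the left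
slope of the norm is at most the normalized Taylor remainder. -/
theorem slope_norm_le_of_dissipative {f : ℝ → V} {f' : V} {t s : ℝ} (hst : s < t)
    (hd : ∀ h : ℝ, 0 < h → ‖f t‖ ≤ ‖f t - h • f'‖) :
    slope (fun t => ‖f t‖) t s ≤ ‖s - t‖⁻¹ * ‖f s - f t - (s - t) • f'‖ := by
  have h1 := hd (t - s) (sub_pos.2 hst)
  have h2 : ‖f t - (t - s) • f'‖ ≤ ‖f s‖ + ‖f s - f t - (s - t) • f'‖ := by
    calc ‖f t - (t - s) • f'‖ = ‖f s - (f s - f t - (s - t) • f')‖ := by congr 1; module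
      _ ≤ _ := norm_sub_le _ _
  have h3 : 0 < t - s := sub_pos.2 hst
  rw [slope_def_field, Real.norm_eq_abs, abs_of_neg (sub_neg.2 hst), neg_sub,
    ← neg_sub t s, div_neg, ← neg_div, div_eq_inv_mul]
  refine mul_le_mul_of_nonneg_left ?_ (by positivity)
  rw [neg_sub t s]
  linarith

/-- The norm along the path is absolutely continuous, so it suffices that its derivative is
nonpositive a.e. -/
theorem norm_le_of_dissipative {f : ℝ → V} {a b : ℝ} (hab : a ≤ b)
    (hf : AbsolutelyContinuousOnInterval f a b)
    (hd : ∀ᵐ t : ℝ, t ∈ Ioo a b →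
      ∃ f', HasDerivAt f f' t ∧ ∀ h : ℝ, 0 < h → ‖f t‖ ≤ ‖f t - h • f'‖) :
    ‖f b‖ ≤ ‖f a‖ := by
  have hn := absolutelyContinuousOnInterval_norm hf
  have hle : ∫ t in a..b, deriv (fun t => ‖f t‖) t ≤ 0 := by
    rw [intervalIntegral.integral_of_le hab, integral_Ioc_eq_integral_Ioo]
    refine integral_nonpos_of_ae ?_
    rw [EventuallyLE, ae_restrict_iff' measurableSet_Ioo]
    filter_upwards [hd, hn.ae_differentiableAt] with t h1 h2 ht
    obtain ⟨f', hf', hdis⟩ := h1 ht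
    have hφ := (h2 (by rw [uIcc_of_le hab]; exact Ioo_subset_Icc_self ht)).hasDerivAt
    -- Since the derivative of the norm exists here, left slopes determine it, and dissipativity
    -- controls exactly these.
    have l1 := (hasDerivAt_iff_tendsto_slope.1 hφ).mono_left
      (nhdsWithin_mono t (s := Iio t) fun s hs => (mem_Iio.1 hs).ne)
    have l2 := (hasDerivAt_iff_tendsto.1 hf').mono_left (nhdsWithin_le_nhds (s := Iio t))
    exact le_of_tendsto_of_tendsto l1 l2 (eventually_mem_nhdsWithin.mono fun s hs =>
      slope_norm_le_of_dissipative hs hdis)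
  rw [hn.integral_deriv_eq_sub] at hle
  linarith

/-- The open sets `{Ψ ≠ 0}` cover everything but the origin, and Lindelöf's property gives a
countable subcover. -/
theorem IsSeparatingSet.exists_countable [TopologicalSpace.SeparableSpace V]
    {Vstar : Set (StrongDual ℝ V)} (h : IsSeparatingSet Vstar) :
    ∃ C ⊆ Vstar, C.Countable ∧ IsSeparatingSet C := by
  have := UniformSpace.secondCountable_of_separable V
  obtain ⟨C, hC, hCc, e⟩ := TopologicalSpace.isOpen_biUnion_countable Vstar
    (fun Ψ => {v : V | Ψ v ≠ 0}) fun Ψ _ => isOpen_ne_fun Ψ.continuous continuous_const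
  refine ⟨C, hC, hCc, fun v hv => h v fun Ψ hΨ => ?_⟩
  by_contra hne
  have : v ∈ ⋃ Ψ ∈ C, {v : V | Ψ v ≠ 0} := by
    rw [e]; exact mem_biUnion hΨ hne
  obtain ⟨Φ, hΦ, hv'⟩ := mem_iUnion₂.1 this
  exact hv' (hv Φ hΦ)

theorem ae_differentiableAt_of_memW11 {X : ℝ → V} {c d : ℝ}
    (h : ∀ a b, c < a → a ≤ b → b < d → MemW11 X a b) :
    ∀ᵐ t : ℝ, t ∈ Ioo c d → DifferentiableAt ℝ X t := by
  have key : ∀ p q : ℚ, ∀ᵐ t : ℝ, c < p → (p : ℝ) ≤ q → (q : ℝ) < d → t ∈ Icc (p : ℝ) q →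
      DifferentiableAt ℝ X t := fun p q => by
    by_cases hpq : c < p ∧ (p : ℝ) ≤ q ∧ (q : ℝ) < d
    · have := (h p q hpq.1 hpq.2.1 hpq.2.2).2
      rw [ae_restrict_iff' measurableSet_Icc] at this
      filter_upwards [this] with t ht _ _ _ using ht
    · exact Eventually.of_forall fun t h1 h2 h3 => absurd ⟨h1, h2, h3⟩ hpq
  filter_upwards [ae_all_iff.2 fun p => ae_all_iff.2 (key p)] with t ht htcd
  obtain ⟨p, hp1, hp2⟩ := exists_rat_btwn htcd.1
  obtain ⟨q, hq1, hq2⟩ := exists_rat_btwn htcd.2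
  exact ht p q hp1 (hp2.trans hq1).le hq2 ⟨hp2.le, hq1.le⟩

/-- A path which satisfies the integral equation tested with a separating set of functionals, and
which is a.e. differentiable, solves the differential equation a.e. -/
theorem ae_hasDerivAt_of_integral_eq [TopologicalSpace.SeparableSpace V]
    {Vstar : Set (StrongDual ℝ V)} (hV : IsSeparatingSet Vstar) {X : ℝ → V} {c d : ℝ} (hc : 0 ≤ c)
    (hW : ∀ a b, c < a → a ≤ b → b < d → MemW11 X a b)
    (hint : ∀ Ψ ∈ Vstar, IntervalIntegrable (fun τ => Ψ (G (X τ))) volume 0 d)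
    (heq : ∀ Ψ ∈ Vstar, ∃ K : ℝ, ∀ t ∈ Ioo c d, Ψ (X t) + ∫ τ in (0)..t, Ψ (G (X τ)) = K) :
    ∀ᵐ t : ℝ, t ∈ Ioo c d → HasDerivAt X (-G (X t)) t := by
  -- Each functional has its own exceptional null set of times; countability permits their union.
  obtain ⟨C, hC, hCc, hCs⟩ := hV.exists_countable
  have key : ∀ᵐ t : ℝ, ∀ Ψ ∈ C, t ∈ uIcc 0 d → ∀ c ∈ uIcc 0 d,
      HasDerivAt (fun t => ∫ τ in c..t, Ψ (G (X τ))) (Ψ (G (X t))) t :=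
    (ae_ball_iff hCc).2 fun Ψ hΨ => (hint Ψ (hC hΨ)).ae_hasDerivAt_integral
  filter_upwards [key, ae_differentiableAt_of_memW11 hW] with t h1 h2 ht
  have hX := (h2 ht).hasDerivAt
  have h0d : (0 : ℝ) ≤ d := (hc.trans ht.1.le).trans ht.2.le
  suffices deriv X t = -G (X t) by rwa [this] at hX
  rw [← sub_eq_zero]
  refine hCs _ fun Ψ hΨ => ?_
  obtain ⟨K, hK⟩ := heq Ψ (hC hΨ)
  have d1 : HasDerivAt (fun s => Ψ (X s)) (Ψ (deriv X t)) t := Ψ.hasFDerivAt.comp_hasDerivAt t hX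
  have d2 := (h1 Ψ hΨ (by rw [uIcc_of_le h0d]; exact ⟨hc.trans ht.1.le, ht.2.le⟩) 0
    left_mem_uIcc).const_sub K
  have d3 : HasDerivAt (fun s => Ψ (X s)) (-Ψ (G (X t))) t := by
    refine d2.congr_of_eventuallyEq ?_
    filter_upwards [Ioo_mem_nhds ht.1 ht.2] with s hs
    linarith [hK s hs]
  rw [map_sub, map_neg, d1.unique d3, sub_self]

variable [CompleteSpace V]

theorem lipschitzOnWith_semigroup_sub (hA : IsMAccretive A) (hdense : Dense (opDomain A))
    (hdom : IsDomainInvariant A) (v : V) {c a : ℝ} (hca : c < a) :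
    ∃ K, LipschitzOnWith K (fun t => semigroup A (t - c) v) (Ici a) := by
  obtain ⟨z, hz⟩ := hdom (a - c) (sub_pos.2 hca) v
  have h1 := lipschitzOnWith_semigroup hA hdense (sub_pos.2 hca).le hz
  refine ⟨‖z‖₊, LipschitzOnWith.of_dist_le_mul fun s hs t ht => ?_⟩
  rw [← dist_sub_right s t c]
  exact h1.dist_le_mul _ (sub_le_sub_right (mem_Ici.1 hs) c) _ (sub_le_sub_right (mem_Ici.1 ht) c)

theorem ae_hasDerivAt_semigroup_sub (hA : IsMAccretive A) (hdense : Dense (opDomain A))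
    (hdom : IsDomainInvariant A) (hG : IsInfinitesimalGenerator A G) (v : V) (c : ℝ) :
    ∀ᵐ t : ℝ, c < t →
      HasDerivAt (fun t => semigroup A (t - c) v) (-G (semigroup A (t - c) v)) t := by
  filter_upwards [(measurePreserving_sub_right volume c).quasiMeasurePreserving.ae
    (ae_hasDerivAt_semigroup hA hdense hdom hG v)] with t ht hct
  exact (ht (sub_pos.2 hct)).comp_sub_const t c

/-- Both paths solve the same equation a.e., so accretivity makes their difference dissipative.
Absolute continuity is available only away from `c`; the comparison therefore starts at `a > c`, and
right continuity handles `a ↓ c`. -/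
theorem eq_semigroup_of_ae_hasDerivAt (hA : IsMAccretive A) (hdense : Dense (opDomain A))
    (hdom : IsDomainInvariant A) (hG : IsInfinitesimalGenerator A G) {X : ℝ → V} {c d : ℝ}
    (hXc : ContinuousWithinAt X (Ici c) c) (hXD : ∀ t ∈ Ioo c d, X t ∈ opDomain A)
    (hW : ∀ a b, c < a → a ≤ b → b < d → MemW11 X a b)
    (hX : ∀ᵐ t : ℝ, t ∈ Ioo c d → HasDerivAt X (-G (X t)) t) {t : ℝ} (ht : t ∈ Ico c d) :
    X t = semigroup A (t - c) (X c) := by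
  rcases ht.1.eq_or_lt with rfl | hct
  · rw [sub_self, semigroup_zero hA hdense]
  set Y : ℝ → V := fun t => semigroup A (t - c) (X c) with hY
  have hle : ∀ a ∈ Ioo c t, ‖X t - Y t‖ ≤ ‖X a - Y a‖ := fun a ha => by
    obtain ⟨K, hK⟩ := lipschitzOnWith_semigroup_sub hA hdense hdom (X c) ha.1
    have hYac : AbsolutelyContinuousOnInterval Y a t :=
      (hK.mono (by rw [uIcc_of_le ha.2.le]; exact Icc_subset_Ici_self)).absolutelyContinuousOnInterval
    refine norm_le_of_dissipative (f := X - Y) ha.2.le ((hW a t ha.1 ha.2.le ht.2).1.sub hYac) ?_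
    filter_upwards [hX, ae_hasDerivAt_semigroup_sub hA hdense hdom hG (X c) c] with s h1 h2 hs
    have hcs : c < s := ha.1.trans hs.1
    have hsd : s ∈ Ioo c d := ⟨hcs, hs.2.trans ht.2⟩
    refine ⟨_, (h1 hsd).sub (h2 hcs), fun h hh => ?_⟩
    have := hA.1 h hh _ _ _ (hG.1 _ (hXD s hsd)).2 _ (hG.1 _ (hdom _ (sub_pos.2 hcs) (X c))).2
    refine this.trans_eq (congrArg norm ?_)
    simp only [Pi.sub_apply, hY]
    module
  have hYc : ContinuousWithinAt Y (Ici c) c := by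
    have h1 : ContinuousWithinAt (fun t => semigroup A t (X c)) (Ici 0) (c - c) := by
      rw [sub_self]
      exact continuousOn_semigroup hA hdense (X c) 0 (mem_Ici.2 le_rfl)
    exact h1.comp (f := fun t => t - c) (by fun_prop) fun s hs => sub_nonneg.2 (mem_Ici.1 hs)
  have lim : Tendsto (fun a => ‖X a - Y a‖) (𝓝[>] c) (𝓝 ‖X c - Y c‖) :=
    ((hXc.sub hYc).norm.tendsto).mono_left (nhdsWithin_mono c Ioi_subset_Ici_self)
  have hYc0 : Y c = X c := by simp only [hY, sub_self, semigroup_zero hA hdense]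
  rw [hYc0, sub_self, norm_zero] at lim
  have := ge_of_tendsto lim (Filter.mem_of_superset (Ioo_mem_nhdsGT hct) hle)
  exact sub_eq_zero.1 (norm_le_zero_iff.1 this)

end Dissipative

/-! ### Integrals of the drift as sums of jumps -/

section Drift

variable {Ω Z V : Type*} {Θ : Ω → PointFunction Z} [NormedAddCommGroup V]
  {η η' : ℝ → Z → Ω → V} {ω : Ω} {m : ℕ} {t : ℝ}

theorem evalAt_comp {E F : Type*} [Zero E] [Zero F] (θ : PointFunction Z) (f : ℝ × Z → E)
    {g : E → F} (hg : g 0 = 0) (s : ℝ) : θ.evalAt (fun p => g (f p)) s = g (θ.evalAt f s) := by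
  unfold PointFunction.evalAt
  split_ifs <;> simp [hg]

theorem evalAt_sub {E : Type*} [AddGroup E] (θ : PointFunction Z) (f g : ℝ × Z → E) (s : ℝ) :
    θ.evalAt (fun p => f p - g p) s = θ.evalAt f s - θ.evalAt g s := by
  unfold PointFunction.evalAt
  split_ifs <;> simp

variable [MeasurableSpace Ω] [MeasurableSpace Z] [MeasurableSpace V]

theorem measurable_indicator_drift (hη : IsMeasurableDrift η) (ω : Ω) :
    Measurable ((Ioi 0 ×ˢ univ : Set (ℝ × Z)).indicator fun p => η p.1 p.2 ω) := by
  classical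
  have hS : MeasurableSet (Ioi 0 ×ˢ univ : Set (ℝ × Z)) := measurableSet_Ioi.prod MeasurableSet.univ
  have h1 : Measurable fun p : (Ioi 0 ×ˢ univ : Set (ℝ × Z)) =>
      ((⟨p.1.1, p.2.1⟩ : Ioi (0 : ℝ)), p.1.2, ω) :=
    (measurable_subtype_coe.fst.subtype_mk).prodMk
      (measurable_subtype_coe.snd.prodMk measurable_const)
  have := Measurable.dite (s := (Ioi 0 ×ˢ univ : Set (ℝ × Z))) (hη.comp h1)
    (measurable_const (a := (0 : V))) hS
  convert this using 1
  ext p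
  simp only [Set.indicator]
  congr

variable [BorelSpace V]

theorem stronglyMeasurable_indicator_norm_drift (hη : IsMeasurableDrift η) (ω : Ω) :
    StronglyMeasurable ((Ioi 0 ×ˢ univ : Set (ℝ × Z)).indicator fun p => ‖η p.1 p.2 ω‖) := by
  have h := (measurable_indicator_drift hη ω).norm
  simp only [norm_indicator_eq_indicator_norm] at h
  exact h.stronglyMeasurable

theorem setIntegral_norm_drift (hω : (Θ ω).IsLocallyFinite) (hη : IsMeasurableDrift η)
    (ht : ENNReal.ofReal t ∈ Ico ((Θ ω).hittingTime m) ((Θ ω).hittingTime (m + 1))) :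
    ∫ p in Ioc 0 t ×ˢ univ, ‖η p.1 p.2 ω‖ ∂(Θ ω).countingMeasure =
      ∑ k ∈ Finset.range m, ‖jumpSize Θ η (k + 1) ω‖ := by
  rw [hω.setIntegral_countingMeasure ht (stronglyMeasurable_indicator_norm_drift hη ω)]
  exact Finset.sum_congr rfl fun k _ => evalAt_comp _ _ norm_zero _

theorem setLIntegral_enorm_sub_drift [TopologicalSpace.SeparableSpace V]
    (hω : (Θ ω).IsLocallyFinite) (hη : IsMeasurableDrift η)
    (hη' : IsMeasurableDrift η')
    (ht : ENNReal.ofReal t ∈ Ico ((Θ ω).hittingTime m) ((Θ ω).hittingTime (m + 1))) :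
    ∫⁻ p in Ioc 0 t ×ˢ univ, ‖η p.1 p.2 ω - η' p.1 p.2 ω‖ₑ ∂(Θ ω).countingMeasure =
      ∑ k ∈ Finset.range m, ‖jumpSize Θ η (k + 1) ω - jumpSize Θ η' (k + 1) ω‖ₑ := by
  have := UniformSpace.secondCountable_of_separable V
  rw [hω.setLIntegral_countingMeasure ht]
  · refine Finset.sum_congr rfl fun k _ => ?_
    rw [evalAt_comp _ (fun p => η p.1 p.2 ω - η' p.1 p.2 ω) enorm_zero, evalAt_sub]
    rfl
  · have h := ((measurable_indicator_drift hη ω).sub (measurable_indicator_drift hη' ω)).enorm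
    convert h using 1
    ext p
    by_cases hp : p ∈ (Ioi 0 ×ˢ univ : Set (ℝ × Z)) <;> simp [hp]

variable [NormedSpace ℝ V]

theorem stronglyMeasurable_indicator_dual_drift (hη : IsMeasurableDrift η) (ω : Ω)
    (Ψ : StrongDual ℝ V) :
    StronglyMeasurable ((Ioi 0 ×ˢ univ : Set (ℝ × Z)).indicator fun p => Ψ (η p.1 p.2 ω)) := by
  have h := Ψ.continuous.measurable.comp (measurable_indicator_drift hη ω)
  rw [← indicator_comp_of_zero (map_zero Ψ)] at h
  exact h.stronglyMeasurable

theorem setIntegral_dual_drift (hω : (Θ ω).IsLocallyFinite) (hη : IsMeasurableDrift η)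
    (ht : ENNReal.ofReal t ∈ Ico ((Θ ω).hittingTime m) ((Θ ω).hittingTime (m + 1)))
    (Ψ : StrongDual ℝ V) :
    ∫ p in Ioc 0 t ×ˢ univ, Ψ (η p.1 p.2 ω) ∂(Θ ω).countingMeasure =
      ∑ k ∈ Finset.range m, Ψ (jumpSize Θ η (k + 1) ω) := by
  rw [hω.setIntegral_countingMeasure ht (stronglyMeasurable_indicator_dual_drift hη ω Ψ)]
  exact Finset.sum_congr rfl fun k _ => evalAt_comp _ _ (map_zero Ψ) _

end Drift

/-! ### Pathwise stability and regularity of the generated process -/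

section Pathwise

variable {Ω Z V : Type*} {Θ : Ω → PointFunction Z} [NormedAddCommGroup V] [NormedSpace ℝ V]
  {A : V → Set V} {G : V → V} {x : Ω → V} {η : ℝ → Z → Ω → V} {ω : Ω} {m : ℕ} {t : ℝ}

theorem toReal_hittingTime_le {θ : PointFunction Z} (ht0 : 0 ≤ t)
    (ht : θ.hittingTime m ≤ ENNReal.ofReal t) : (θ.hittingTime m).toReal ≤ t :=
  ENNReal.toReal_le_of_le_ofReal ht0 ht

theorem generatedSol_eq_of_nonneg (A : V → Set V) (x : Ω → V) (η : ℝ → Z → Ω → V) (ht0 : 0 ≤ t)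
    (ht : ENNReal.ofReal t ∈ Ico ((Θ ω).hittingTime m) ((Θ ω).hittingTime (m + 1))) :
    generatedSol A Θ x η t ω =
      semigroup A (t - ((Θ ω).hittingTime m).toReal) (jumpSequence A Θ x η m ω) := by
  rw [generatedSol_eq A Θ x η ht, max_eq_left (sub_nonneg.2 (toReal_hittingTime_le ht0 ht.1))]

theorem jumpSequence_succ (A : V → Set V) (x : Ω → V) (η : ℝ → Z → Ω → V)
    (h : (Θ ω).hittingTime (m + 1) ≠ ∞) :
    jumpSequence A Θ x η (m + 1) ω =
      semigroup A (((Θ ω).hittingTime (m + 1)).toReal - ((Θ ω).hittingTime m).toReal)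
        (jumpSequence A Θ x η m ω) + jumpSize Θ η (m + 1) ω := by
  rw [jumpSequence, ENNReal.toReal_sub_of_le (PointFunction.monotone_hittingTime m.le_succ) h]

/-- Invariance keeps the semigroup part in `W`, and linearity allows the jump to be added; the
default jump `0` is also in `W`. -/
theorem jumpSequence_mem {W : Submodule ℝ V} (hWinv : IsInvariantSet A (W : Set V))
    (hx : x ω ∈ W) (hη : ∀ s z, η s z ω ∈ W) (m : ℕ) : jumpSequence A Θ x η m ω ∈ W := by
  induction m with
  | zero => exact hx
  | succ m ih =>
    refine W.add_mem (hWinv _ ENNReal.toReal_nonneg _ ih) ?_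
    unfold jumpSize
    split_ifs
    · exact hη _ _
    · exact W.zero_mem

variable [CompleteSpace V]

/-- Errors do not grow between jumps and only add at jumps. -/
theorem norm_jumpSequence_sub_le (hA : IsMAccretive A) (hdense : Dense (opDomain A))
    (x x' : Ω → V) (η η' : ℝ → Z → Ω → V) (m : ℕ) (ω : Ω) :
    ‖jumpSequence A Θ x η m ω - jumpSequence A Θ x' η' m ω‖ ≤ ‖x ω - x' ω‖ +
      ∑ k ∈ Finset.range m, ‖jumpSize Θ η (k + 1) ω - jumpSize Θ η' (k + 1) ω‖ := by
  induction m with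
  | zero => simp [jumpSequence]
  | succ m ih =>
    rw [Finset.sum_range_succ, ← add_assoc, jumpSequence, jumpSequence, add_sub_add_comm]
    exact (norm_add_le _ _).trans (add_le_add_left
      ((norm_semigroup_sub_le hA hdense ENNReal.toReal_nonneg _ _).trans ih) _)

theorem norm_generatedSol_sub_le (hA : IsMAccretive A) (hdense : Dense (opDomain A))
    (x x' : Ω → V) (η η' : ℝ → Z → Ω → V)
    (ht : ENNReal.ofReal t ∈ Ico ((Θ ω).hittingTime m) ((Θ ω).hittingTime (m + 1))) :
    ‖generatedSol A Θ x η t ω - generatedSol A Θ x' η' t ω‖ ≤ ‖x ω - x' ω‖ +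
      ∑ k ∈ Finset.range m, ‖jumpSize Θ η (k + 1) ω - jumpSize Θ η' (k + 1) ω‖ := by
  rw [generatedSol_eq A Θ x η ht, generatedSol_eq A Θ x' η' ht]
  exact (norm_semigroup_sub_le hA hdense (le_max_right _ _) _ _).trans
    (norm_jumpSequence_sub_le hA hdense x x' η η' m ω)

theorem norm_jumpSequence_le (hA : IsMAccretive A) (hdense : Dense (opDomain A))
    (h0 : (0 : V) ∈ A 0) (x : Ω → V) (η : ℝ → Z → Ω → V) (m : ℕ) (ω : Ω) :
    ‖jumpSequence A Θ x η m ω‖ ≤ ‖x ω‖ +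
      ∑ k ∈ Finset.range m, ‖jumpSize Θ η (k + 1) ω‖ := by
  induction m with
  | zero => simp [jumpSequence]
  | succ m ih =>
    rw [Finset.sum_range_succ, ← add_assoc, jumpSequence]
    refine (norm_add_le _ _).trans (add_le_add_left (le_trans ?_ ih) _)
    simpa [semigroup_apply_zero hA hdense ENNReal.toReal_nonneg h0] using
      norm_semigroup_sub_le hA hdense ENNReal.toReal_nonneg (jumpSequence A Θ x η m ω) 0

theorem norm_generatedSol_le (hA : IsMAccretive A) (hdense : Dense (opDomain A))
    (h0 : (0 : V) ∈ A 0) (x : Ω → V) (η : ℝ → Z → Ω → V)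
    (ht : ENNReal.ofReal t ∈ Ico ((Θ ω).hittingTime m) ((Θ ω).hittingTime (m + 1))) :
    ‖generatedSol A Θ x η t ω‖ ≤ ‖x ω‖ +
      ∑ k ∈ Finset.range m, ‖jumpSize Θ η (k + 1) ω‖ := by
  rw [generatedSol_eq A Θ x η ht]
  refine le_trans ?_ (norm_jumpSequence_le hA hdense h0 x η m ω)
  simpa [semigroup_apply_zero hA hdense (le_max_right _ _) h0] using
    norm_semigroup_sub_le hA hdense (le_max_right _ 0) (jumpSequence A Θ x η m ω) 0

theorem generatedSol_zero (hA : IsMAccretive A) (hdense : Dense (opDomain A))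
    (hω : (Θ ω).IsLocallyFinite) : generatedSol A Θ x η 0 ω = x ω := by
  have h : ENNReal.ofReal 0 ∈ Ico ((Θ ω).hittingTime 0) ((Θ ω).hittingTime (0 + 1)) := by
    rw [ENNReal.ofReal_zero]
    exact ⟨le_rfl, hω.hittingTime_lt_succ ENNReal.zero_ne_top⟩
  rw [generatedSol_eq_of_nonneg A x η le_rfl h]
  simp [PointFunction.hittingTime_zero, semigroup_zero hA hdense, jumpSequence]

theorem isCadlag_generatedSol (hA : IsMAccretive A) (hdense : Dense (opDomain A))
    (hω : (Θ ω).IsLocallyFinite) : IsCadlag fun t => generatedSol A Θ x η t ω := by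
  have hcont : ∀ m, Continuous fun t : ℝ =>
      semigroup A (max (t - ((Θ ω).hittingTime m).toReal) 0) (jumpSequence A Θ x η m ω) := fun m =>
    (continuous_semigroup_max hA hdense _).comp (f := fun t => t - ((Θ ω).hittingTime m).toReal)
      (by fun_prop)
  refine ⟨fun t ht => ?_, fun t ht => ?_⟩
  · obtain ⟨m, hm⟩ := hω.exists_mem_Ico t
    refine (hcont m).continuousWithinAt.congr_of_eventuallyEq ?_ (generatedSol_eq A Θ x η hm)
    filter_upwards [self_mem_nhdsWithin, nhdsWithin_le_nhds
      (ENNReal.continuous_ofReal.continuousAt.eventually (gt_mem_nhds hm.2))] with s h1 h2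
    exact generatedSol_eq A Θ x η ⟨hm.1.trans (ENNReal.ofReal_le_ofReal h1), h2⟩
  -- For left limits the half-open interval is reversed: a time equal to `α_{m+1}` is approached
  -- along the piece starting at `α_m`.
  · obtain ⟨m, hm1, hm2⟩ : ∃ m, (Θ ω).hittingTime m < ENNReal.ofReal t ∧
        ENNReal.ofReal t ≤ (Θ ω).hittingTime (m + 1) := by
      obtain ⟨m, hm⟩ := hω.exists_mem_Ico t
      rcases hm.1.eq_or_lt with e | h
      · cases m with
        | zero =>
          rw [PointFunction.hittingTime_zero, eq_comm, ENNReal.ofReal_eq_zero] at e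
          exact absurd ht (not_lt.2 e)
        | succ m =>
          refine ⟨m, ?_, e.ge⟩
          rw [← e]
          refine hω.hittingTime_lt_succ (ne_top_of_le_ne_top ?_
            (PointFunction.monotone_hittingTime m.le_succ))
          rw [e]; exact ENNReal.ofReal_ne_top
      · exact ⟨m, h, hm.2.le⟩
    refine ⟨_, (((hcont m).tendsto t).mono_left nhdsWithin_le_nhds).congr' ?_⟩
    filter_upwards [self_mem_nhdsWithin, nhdsWithin_le_nhds
      (ENNReal.continuous_ofReal.continuousAt.eventually (lt_mem_nhds hm1))] with s h1 h2
    exact (generatedSol_eq A Θ x η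
      ⟨h2.le, ((ENNReal.ofReal_lt_ofReal_iff ht).2 h1).trans_le hm2⟩).symm

theorem isRegularPath_generatedSol (hA : IsMAccretive A) (hdense : Dense (opDomain A))
    (hdom : IsDomainInvariant A) (hG : IsInfinitesimalGenerator A G)
    (hω : (Θ ω).IsLocallyFinite) :
    IsRegularPath A (Θ ω) (x ω) fun t => generatedSol A Θ x η t ω where
  initial := generatedSol_zero hA hdense hω
  cadlag := isCadlag_generatedSol hA hdense hω
  mem_domain t ht hne := by
    obtain ⟨m, hm⟩ := hω.exists_mem_Ico t
    have hlt : (Θ ω).hittingTime m < ENNReal.ofReal t := by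
      refine hm.1.lt_of_ne fun e => ?_
      cases m with
      | zero =>
        rw [PointFunction.hittingTime_zero, eq_comm, ENNReal.ofReal_eq_zero] at e
        exact absurd ht (not_lt.2 e)
      | succ m => exact hne (m + 1) (by omega) e.symm
    rw [generatedSol_eq_of_nonneg A x η ht.le hm]
    refine hdom _ (sub_pos.2 ?_) _
    have := (ENNReal.toReal_lt_toReal hlt.ne_top ENNReal.ofReal_ne_top).2 hlt
    rwa [ENNReal.toReal_ofReal ht.le] at this
  memW11 m a b hab ha hb := by
    have ha0 : 0 < a := ENNReal.ofReal_pos.1 (zero_le.trans_lt ha)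
    set c := ((Θ ω).hittingTime m).toReal with hc
    have hca : c < a := by
      have := (ENNReal.toReal_lt_toReal ha.ne_top ENNReal.ofReal_ne_top).2 ha
      rwa [ENNReal.toReal_ofReal ha0.le] at this
    -- Near every time in `[a, b]` the process is one and the same shifted orbit, so Lipschitz
    -- continuity and differentiability carry over.
    have hev : ∀ s ∈ Icc a b, ∀ᶠ r in 𝓝 s, generatedSol A Θ x η r ω =
        semigroup A (r - c) (jumpSequence A Θ x η m ω) := fun s hs => by
      filter_upwards [ENNReal.continuous_ofReal.continuousAt.eventually
          (lt_mem_nhds (ha.trans_le (ENNReal.ofReal_le_ofReal hs.1))),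
        ENNReal.continuous_ofReal.continuousAt.eventually
          (gt_mem_nhds ((ENNReal.ofReal_le_ofReal hs.2).trans_lt hb)),
        lt_mem_nhds (ha0.trans_le hs.1)] with r h1 h2 h3
      exact generatedSol_eq_of_nonneg A x η h3.le ⟨h1.le, h2⟩
    obtain ⟨K, hK⟩ := lipschitzOnWith_semigroup_sub hA hdense hdom (jumpSequence A Θ x η m ω) hca
    refine ⟨?_, ?_⟩
    · refine LipschitzOnWith.absolutelyContinuousOnInterval (K := K) ?_
      rw [uIcc_of_le hab]
      refine LipschitzOnWith.of_dist_le_mul fun s hs r hr => ?_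
      rw [(hev s hs).self_of_nhds, (hev r hr).self_of_nhds]
      exact hK.dist_le_mul s hs.1 r hr.1
    · rw [ae_restrict_iff' measurableSet_Icc]
      filter_upwards [ae_hasDerivAt_semigroup_sub hA hdense hdom hG
        (jumpSequence A Θ x η m ω) c] with s hs hsab
      exact ((hs (hca.trans_le hsab.1)).congr_of_eventuallyEq (hev s hsab)).differentiableAt

end Pathwise

/-! ### The tested integral equation for the generated process -/

section IntegralEquation

variable {Ω Z V : Type*} {Θ : Ω → PointFunction Z} [NormedAddCommGroup V] [NormedSpace ℝ V]
  [CompleteSpace V] {A : V → Set V} {G : V → V} {x : Ω → V} {η : ℝ → Z → Ω → V} {ω : Ω}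
  {m : ℕ} {t : ℝ}

/-- Fundamental theorem of calculus for a continuous function with a right derivative at every
interior time; integrability is all that remains to be assumed. -/
theorem integral_generator_semigroup (hA : IsMAccretive A) (hdense : Dense (opDomain A))
    (hdom : IsDomainInvariant A) (hG : IsInfinitesimalGenerator A G) {u : V} (Ψ : StrongDual ℝ V)
    (ht : 0 ≤ t)
    (hi : IntervalIntegrable (fun τ => Ψ (G (semigroup A τ u))) volume 0 t) :
    ∫ τ in (0)..t, Ψ (G (semigroup A τ u)) = Ψ u - Ψ (semigroup A t u) := by
  have h := intervalIntegral.integral_eq_sub_of_hasDeriv_right_of_le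
    (f := fun τ => -Ψ (semigroup A τ u)) ht
    ((Ψ.continuous.comp_continuousOn
      ((continuousOn_semigroup hA hdense u).mono Icc_subset_Ici_self)).neg)
    (fun s hs => by
      have := (Ψ.hasFDerivAt.comp_hasDerivWithinAt s
        (hasDerivWithinAt_semigroup hA hdense hdom hG u hs.1)).neg
      rw [map_neg, neg_neg] at this
      exact this) hi
  rw [h, semigroup_zero hA hdense]
  ring

theorem intervalIntegrable_zero {f : ℝ → ℝ} (hi : ∀ t : ℝ, 0 < t → IntegrableOn f (Ioo 0 t))
    (ht : 0 ≤ t) : IntervalIntegrable f volume 0 t := by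
  rcases ht.eq_or_lt with rfl | h
  · exact IntervalIntegrable.refl
  · exact (intervalIntegrable_iff_integrableOn_Ioo_of_le ht).2 (hi t h)

/-- A time shift by `α_m` reduces to a single orbit. The endpoint `t = α_{m+1}` is allowed because
the value after the jump sits on a null set. -/
theorem integral_generatedSol_piece (hA : IsMAccretive A) (hdense : Dense (opDomain A))
    (hdom : IsDomainInvariant A) (hG : IsInfinitesimalGenerator A G) (Ψ : StrongDual ℝ V)
    (hi : ∀ t : ℝ, 0 < t →
      IntegrableOn (fun τ => Ψ (G (semigroup A τ (jumpSequence A Θ x η m ω)))) (Ioo 0 t))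
    (hm : (Θ ω).hittingTime m ≠ ∞) (h1 : ((Θ ω).hittingTime m).toReal ≤ t)
    (h2 : ENNReal.ofReal t ≤ (Θ ω).hittingTime (m + 1)) :
    IntervalIntegrable (fun τ => Ψ (G (generatedSol A Θ x η τ ω))) volume
        ((Θ ω).hittingTime m).toReal t ∧
      ∫ τ in ((Θ ω).hittingTime m).toReal..t, Ψ (G (generatedSol A Θ x η τ ω)) =
        Ψ (jumpSequence A Θ x η m ω) -
          Ψ (semigroup A (t - ((Θ ω).hittingTime m).toReal) (jumpSequence A Θ x η m ω)) := by
  set c := ((Θ ω).hittingTime m).toReal with hc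
  set u := jumpSequence A Θ x η m ω
  have hc0 : 0 ≤ c := ENNReal.toReal_nonneg
  have hi' := intervalIntegrable_zero hi (sub_nonneg.2 h1)
  have hi2 : IntervalIntegrable (fun τ => Ψ (G (semigroup A (τ - c) u))) volume c t := by
    simpa using hi'.comp_sub_right c
  have heq : EqOn (fun τ => Ψ (G (semigroup A (τ - c) u)))
      (fun τ => Ψ (G (generatedSol A Θ x η τ ω))) (Ioo c t) := fun s hs => by
    have hs0 : 0 < s := hc0.trans_lt hs.1
    simp only
    rw [generatedSol_eq_of_nonneg A x η hs0.le
      ⟨?_, ((ENNReal.ofReal_lt_ofReal_iff (hs0.trans hs.2)).2 hs.2).trans_le h2⟩]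
    exact (ENNReal.le_ofReal_iff_toReal_le hm hs0.le).2 hs.1.le
  refine ⟨?_, ?_⟩
  · rw [intervalIntegrable_iff_integrableOn_Ioo_of_le h1] at hi2 ⊢
    exact hi2.congr_fun heq measurableSet_Ioo
  · rw [intervalIntegral.integral_of_le h1, integral_Ioc_eq_integral_Ioo,
      ← setIntegral_congr_fun measurableSet_Ioo heq, ← integral_Ioc_eq_integral_Ioo,
      ← intervalIntegral.integral_of_le h1,
      intervalIntegral.integral_comp_sub_right (fun τ => Ψ (G (semigroup A τ u))) c, sub_self]
    exact integral_generator_semigroup hA hdense hdom hG Ψ (sub_nonneg.2 h1) hi'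

/-- The pieces telescope: the drop over each piece is compensated by the next post-jump value,
except for the jump itself. -/
theorem integral_generatedSol_hittingTime (hA : IsMAccretive A) (hdense : Dense (opDomain A))
    (hdom : IsDomainInvariant A) (hG : IsInfinitesimalGenerator A G)
    (Ψ : StrongDual ℝ V)
    (hi : ∀ m, ∀ t : ℝ, 0 < t →
      IntegrableOn (fun τ => Ψ (G (semigroup A τ (jumpSequence A Θ x η m ω)))) (Ioo 0 t))
    (hm : (Θ ω).hittingTime m ≠ ∞) :
    IntervalIntegrable (fun τ => Ψ (G (generatedSol A Θ x η τ ω))) volume 0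
        ((Θ ω).hittingTime m).toReal ∧
      Ψ (jumpSequence A Θ x η m ω - x ω) +
        ∫ τ in (0)..((Θ ω).hittingTime m).toReal, Ψ (G (generatedSol A Θ x η τ ω)) =
        ∑ k ∈ Finset.range m, Ψ (jumpSize Θ η (k + 1) ω) := by
  induction m with
  | zero => simp [PointFunction.hittingTime_zero, jumpSequence]
  | succ m ih =>
    have hm' := ne_top_of_le_ne_top hm (PointFunction.monotone_hittingTime m.le_succ)
    obtain ⟨i1, e1⟩ := ih hm'
    obtain ⟨i2, e2⟩ := integral_generatedSol_piece hA hdense hdom hG Ψ (hi m) hm'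
      (ENNReal.toReal_mono hm (PointFunction.monotone_hittingTime m.le_succ))
      (ENNReal.ofReal_toReal hm).le
    refine ⟨i1.trans i2, ?_⟩
    rw [← intervalIntegral.integral_add_adjacent_intervals i1 i2, e2, Finset.sum_range_succ, ← e1,
      jumpSequence_succ A x η hm]
    simp only [map_sub, map_add]
    ring

theorem integral_generatedSol (hA : IsMAccretive A) (hdense : Dense (opDomain A))
    (hdom : IsDomainInvariant A) (hG : IsInfinitesimalGenerator A G)
    (Ψ : StrongDual ℝ V)
    (hi : ∀ m, ∀ t : ℝ, 0 < t →
      IntegrableOn (fun τ => Ψ (G (semigroup A τ (jumpSequence A Θ x η m ω)))) (Ioo 0 t))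
    (ht0 : 0 ≤ t)
    (ht : ENNReal.ofReal t ∈ Ico ((Θ ω).hittingTime m) ((Θ ω).hittingTime (m + 1))) :
    IntegrableOn (fun τ => Ψ (G (generatedSol A Θ x η τ ω))) (Ioo 0 t) ∧
      Ψ (generatedSol A Θ x η t ω - x ω) +
        ∫ τ in Ioo 0 t, Ψ (G (generatedSol A Θ x η τ ω)) =
        ∑ k ∈ Finset.range m, Ψ (jumpSize Θ η (k + 1) ω) := by
  have hm := (ht.1.trans_lt ENNReal.ofReal_lt_top).ne
  obtain ⟨i1, e1⟩ := integral_generatedSol_hittingTime hA hdense hdom hG Ψ hi hm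
  obtain ⟨i2, e2⟩ := integral_generatedSol_piece hA hdense hdom hG Ψ (hi m) hm
    (toReal_hittingTime_le ht0 ht.1) ht.2.le
  refine ⟨(intervalIntegrable_iff_integrableOn_Ioo_of_le ht0).1 (i1.trans i2), ?_⟩
  rw [← integral_Ioc_eq_integral_Ioo, ← intervalIntegral.integral_of_le ht0,
    ← intervalIntegral.integral_add_adjacent_intervals i1 i2, e2, ← e1,
    generatedSol_eq_of_nonneg A x η ht0 ht]
  simp only [map_sub]
  ring

end IntegralEquation

/-! ### Strong solutions coincide with the generated process -/

section Uniqueness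

variable {Ω Z V : Type*} {Θ : Ω → PointFunction Z} [NormedAddCommGroup V] [NormedSpace ℝ V]
  [CompleteSpace V] [TopologicalSpace.SeparableSpace V] {A : V → Set V} {G : V → V}
  {x : Ω → V} {η : ℝ → Z → Ω → V} {ω : Ω} {Vstar : Set (StrongDual ℝ V)} {X : ℝ → V}

/-- Between two consecutive hitting times, a strong solution is given by the semigroup. -/
theorem IsRegularPath.eq_semigroup (hA : IsMAccretive A) (hdense : Dense (opDomain A))
    (hdom : IsDomainInvariant A) (hG : IsInfinitesimalGenerator A G) (hV : IsSeparatingSet Vstar)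
    {θ : PointFunction Z} {x₀ : V} (hX : IsRegularPath A θ x₀ X)
    (hint : ∀ t : ℝ, 0 < t → ∀ Ψ ∈ Vstar, IntegrableOn (fun τ => Ψ (G (X τ))) (Ioo 0 t))
    {m : ℕ} (hm : θ.hittingTime m ≠ ∞)
    (heq : ∀ Ψ ∈ Vstar, ∃ K : ℝ, ∀ t : ℝ, θ.hittingTime m < ENNReal.ofReal t →
      ENNReal.ofReal t < θ.hittingTime (m + 1) → Ψ (X t) + ∫ τ in (0)..t, Ψ (G (X τ)) = K)
    {d : ℝ} (hd : ENNReal.ofReal d ≤ θ.hittingTime (m + 1)) {t : ℝ}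
    (ht : t ∈ Ico (θ.hittingTime m).toReal d) :
    X t = semigroup A (t - (θ.hittingTime m).toReal) (X (θ.hittingTime m).toReal) := by
  set c := (θ.hittingTime m).toReal with hc
  have hc0 : 0 ≤ c := ENNReal.toReal_nonneg
  have hgt : ∀ s, c < s → θ.hittingTime m < ENNReal.ofReal s := fun s hs =>
    (ENNReal.lt_ofReal_iff_toReal_lt hm).2 hs
  have hlt : ∀ s, 0 ≤ s → s < d → ENNReal.ofReal s < θ.hittingTime (m + 1) := fun s hs0 hs =>
    ((ENNReal.ofReal_lt_ofReal_iff (hs0.trans_lt hs)).2 hs).trans_le hd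
  have hd0 : 0 ≤ d := hc0.trans (ht.1.trans ht.2.le)
  have hW : ∀ a b, c < a → a ≤ b → b < d → MemW11 X a b := fun a b hca hab hbd =>
    hX.memW11 m a b hab (hgt a hca) (hlt b (hc0.trans (hca.le.trans hab)) hbd)
  refine eq_semigroup_of_ae_hasDerivAt hA hdense hdom hG (hX.cadlag.1 c hc0) (fun s hs => ?_) hW
    (ae_hasDerivAt_of_integral_eq hV hc0 hW
      (fun Ψ hΨ => intervalIntegrable_zero (fun s hs => hint s hs Ψ hΨ) hd0) fun Ψ hΨ => ?_) ht
  · have h1 := hgt s hs.1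
    have h2 := hlt s (hc0.trans hs.1.le) hs.2
    refine hX.mem_domain s (hc0.trans_lt hs.1) fun n _ e => ?_
    rw [e] at h1 h2
    have := PointFunction.monotone_hittingTime.reflect_lt h1
    have := PointFunction.monotone_hittingTime.reflect_lt h2
    omega
  · obtain ⟨K, hK⟩ := heq Ψ hΨ
    exact ⟨K, fun s hs => hK s (hgt s hs.1) (hlt s (hc0.trans hs.1.le) hs.2)⟩

theorem IsRegularPath.eq_generatedSol (hA : IsMAccretive A) (hdense : Dense (opDomain A))
    (hdom : IsDomainInvariant A) (hG : IsInfinitesimalGenerator A G) (hV : IsSeparatingSet Vstar)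
    (hω : (Θ ω).IsLocallyFinite) (hX : IsRegularPath A (Θ ω) (x ω) X)
    (hint : ∀ t : ℝ, 0 < t → ∀ Ψ ∈ Vstar, IntegrableOn (fun τ => Ψ (G (X τ))) (Ioo 0 t))
    (heq : ∀ t : ℝ, 0 < t → ∀ Ψ ∈ Vstar, ∀ m,
      ENNReal.ofReal t ∈ Ico ((Θ ω).hittingTime m) ((Θ ω).hittingTime (m + 1)) →
      Ψ (X t - x ω) + ∫ τ in Ioo 0 t, Ψ (G (X τ)) =
        ∑ k ∈ Finset.range m, Ψ (jumpSize Θ η (k + 1) ω))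
    {t : ℝ} (ht : 0 ≤ t) : X t = generatedSol A Θ x η t ω := by
  have heq' : ∀ t : ℝ, 0 < t → ∀ Ψ ∈ Vstar, ∀ m,
      ENNReal.ofReal t ∈ Ico ((Θ ω).hittingTime m) ((Θ ω).hittingTime (m + 1)) →
      Ψ (X t) + ∫ τ in (0)..t, Ψ (G (X τ)) =
        Ψ (x ω) + ∑ k ∈ Finset.range m, Ψ (jumpSize Θ η (k + 1) ω) := fun t ht Ψ hΨ m htm => by
    rw [intervalIntegral.integral_of_le ht.le, integral_Ioc_eq_integral_Ioo, ← heq t ht Ψ hΨ m htm,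
      map_sub]
    ring
  have hpiece : ∀ m, (Θ ω).hittingTime m ≠ ∞ → ∀ d : ℝ,
      ENNReal.ofReal d ≤ (Θ ω).hittingTime (m + 1) → ∀ t ∈ Ico ((Θ ω).hittingTime m).toReal d,
      X t = semigroup A (t - ((Θ ω).hittingTime m).toReal) (X ((Θ ω).hittingTime m).toReal) :=
    fun m hm d hd t ht => hX.eq_semigroup hA hdense hdom hG hV hint hm
      (fun Ψ hΨ => ⟨_, fun t h1 h2 =>
        heq' t (ENNReal.ofReal_pos.1 (zero_le.trans_lt h1)) Ψ hΨ m ⟨h1.le, h2⟩⟩) hd ht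
  have hjump : ∀ m, (Θ ω).hittingTime m ≠ ∞ →
      X ((Θ ω).hittingTime m).toReal = jumpSequence A Θ x η m ω := by
    intro m hm
    induction m with
    | zero => simpa [PointFunction.hittingTime_zero, jumpSequence] using hX.initial
    | succ m ih =>
      have hm' := ne_top_of_le_ne_top hm (PointFunction.monotone_hittingTime m.le_succ)
      have hp := hpiece m hm' _ (ENNReal.ofReal_toReal hm).le
      rw [ih hm'] at hp
      rw [jumpSequence_succ A x η hm, ← sub_eq_zero]
      set c := ((Θ ω).hittingTime m).toReal with hc
      set d := ((Θ ω).hittingTime (m + 1)).toReal with hd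
      have hcd : c < d := (ENNReal.toReal_lt_toReal hm' hm).2 (hω.hittingTime_lt_succ hm')
      have hc0 : 0 ≤ c := ENNReal.toReal_nonneg
      refine hV _ fun Ψ hΨ => ?_
      have hi := intervalIntegrable_zero (fun s hs => hint s hs Ψ hΨ) (hc0.trans hcd.le)
      have e1 := heq' d (hc0.trans_lt hcd) Ψ hΨ (m + 1)
        (by rw [hd, ENNReal.ofReal_toReal hm]; exact ⟨le_rfl, hω.hittingTime_lt_succ hm⟩)
      -- The same expression is evaluated twice as `s ↑ α_{m+1}`: here by continuity of the orbit
      -- and of the integral, and in `l2` as the constant from the tested equation before the jump.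
      -- Comparison with `e1`, the equation at the jump, isolates the jump.
      have l1 : Tendsto (fun s => Ψ (semigroup A (s - c) (jumpSequence A Θ x η m ω)) +
          ∫ τ in (0)..s, Ψ (G (X τ))) (𝓝[Ioo c d] d)
          (𝓝 (Ψ (semigroup A (d - c) (jumpSequence A Θ x η m ω)) +
            ∫ τ in (0)..d, Ψ (G (X τ)))) := by
        refine Tendsto.add ?_ ?_
        · refine (Ψ.continuous.tendsto _).comp ?_
          have := ((continuousOn_semigroup hA hdense (jumpSequence A Θ x η m ω)).comp
            (f := fun s => s - c) (s := Ici c) (by fun_prop)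
            fun s hs => sub_nonneg.2 (mem_Ici.1 hs)) d hcd.le
          exact this.tendsto.mono_left (nhdsWithin_mono d fun s hs => hs.1.le)
        · have := (intervalIntegral.continuousOn_primitive_interval' hi left_mem_uIcc) d
            right_mem_uIcc
          refine this.tendsto.mono_left (nhdsWithin_mono d fun s hs => ?_)
          rw [uIcc_of_le (hc0.trans hcd.le)]
          exact ⟨hc0.trans hs.1.le, hs.2.le⟩
      have l2 : Tendsto (fun s => Ψ (semigroup A (s - c) (jumpSequence A Θ x η m ω)) +
          ∫ τ in (0)..s, Ψ (G (X τ))) (𝓝[Ioo c d] d)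
          (𝓝 (Ψ (x ω) + ∑ k ∈ Finset.range m, Ψ (jumpSize Θ η (k + 1) ω))) := by
        refine tendsto_const_nhds.congr' ?_
        filter_upwards [self_mem_nhdsWithin] with s hs
        rw [← hp s ⟨hs.1.le, hs.2⟩]
        refine (heq' s (hc0.trans_lt hs.1) Ψ hΨ m ⟨?_, ?_⟩).symm
        · exact ((ENNReal.lt_ofReal_iff_toReal_lt hm').2 hs.1).le
        · exact (ENNReal.ofReal_lt_iff_lt_toReal (hc0.trans hs.1.le) hm).2 hs.2
      have : (𝓝[Ioo c d] d).NeBot := by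
        rw [← mem_closure_iff_nhdsWithin_neBot, closure_Ioo hcd.ne]
        exact right_mem_Icc.2 hcd.le
      have e2 := tendsto_nhds_unique l1 l2
      rw [Finset.sum_range_succ] at e1
      simp only [map_sub, map_add]
      linarith
  obtain ⟨m, hm⟩ := hω.exists_mem_Ico t
  have hm' := (hm.1.trans_lt ENNReal.ofReal_lt_top).ne
  -- A finite right endpoint is needed because `α_{m+1}` may be infinite.
  obtain ⟨d, hd0, hd1, hd2⟩ := exists_rat_ofReal_between hm.2
  rw [generatedSol_eq_of_nonneg A x η ht hm, ← hjump m hm']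
  exact hpiece m hm' d hd2.le t ⟨toReal_hittingTime_le ht hm.1,
    (ENNReal.ofReal_lt_ofReal_iff_of_nonneg ht).1 hd1⟩

end Uniqueness

/-! ### Approximation of the data -/

/-- Points of a separable space are approximated measurably by points of a dense set. -/
theorem exists_measurable_approx {V : Type*} [NormedAddCommGroup V]
    [TopologicalSpace.SeparableSpace V] [MeasurableSpace V] [BorelSpace V] {W : Set V}
    (hW : Dense W) {ε : ℝ} (hε : 0 < ε) :
    ∃ f : V → V, Measurable f ∧ ∀ v, f v ∈ W ∧ ‖f v - v‖ ≤ ε := by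
  classical
  have := UniformSpace.secondCountable_of_separable V
  have : Nonempty W := hW.nonempty.to_subtype
  have hd : DenseRange fun n => (TopologicalSpace.denseSeq W n : V) :=
    hW.denseRange_val.comp (TopologicalSpace.denseRange_denseSeq W) continuous_subtype_val
  have hex : ∀ v : V, ∃ n, ‖(TopologicalSpace.denseSeq W n : V) - v‖ < ε := fun v => by
    obtain ⟨n, hn⟩ := hd.exists_dist_lt v hε
    exact ⟨n, by rwa [norm_sub_rev, ← dist_eq_norm]⟩
  refine ⟨fun v => TopologicalSpace.denseSeq W (Nat.find (hex v)), ?_, fun v =>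
    ⟨Subtype.coe_prop _, (Nat.find_spec (hex v)).le⟩⟩
  have h1 : Measurable fun v => Nat.find (hex v) := measurable_find hex fun k =>
    (isOpen_lt (by fun_prop) continuous_const).measurableSet
  exact (measurable_from_nat (f := fun n => (TopologicalSpace.denseSeq W n : V))).comp h1

/-- Along a fixed path the integral has finitely many terms, each at most `ε n`. -/
theorem tendsto_lintegral_drift {Ω Z V : Type*} [MeasurableSpace Ω] [MeasurableSpace Z]
    [NormedAddCommGroup V] [TopologicalSpace.SeparableSpace V] [MeasurableSpace V] [BorelSpace V]
    {Θ : Ω → PointFunction Z} {η : ℝ → Z → Ω → V} {ω : Ω} (hω : (Θ ω).IsLocallyFinite)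
    {ηs : ℕ → ℝ → Z → Ω → V} (hηs : ∀ n, IsMeasurableDrift (ηs n)) (hη : IsMeasurableDrift η)
    {ε : ℕ → ℝ} (hε : Tendsto ε atTop (𝓝 0)) (hε0 : ∀ n, 0 ≤ ε n)
    (h : ∀ n s z, ‖ηs n s z ω - η s z ω‖ ≤ ε n) (t : ℝ) :
    Tendsto (fun n => ∫⁻ p in Ioc 0 t ×ˢ univ, ‖ηs n p.1 p.2 ω - η p.1 p.2 ω‖ₑ
      ∂(Θ ω).countingMeasure) atTop (𝓝 0) := by
  obtain ⟨m, hm⟩ := hω.exists_mem_Ico t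
  simp only [setLIntegral_enorm_sub_drift hω (hηs _) hη hm]
  have lim : Tendsto (fun n => ∑ _k ∈ Finset.range m, ENNReal.ofReal (ε n)) atTop
      (𝓝 (∑ _k ∈ Finset.range m, 0)) :=
    tendsto_finsetSum _ fun _ _ => by simpa using ENNReal.tendsto_ofReal hε
  rw [Finset.sum_const_zero] at lim
  refine tendsto_of_tendsto_of_tendsto_of_le_of_le tendsto_const_nhds lim (fun _ => zero_le)
    fun n => Finset.sum_le_sum fun k _ => ?_
  rw [← ofReal_norm]
  refine ENNReal.ofReal_le_ofReal ?_
  unfold jumpSize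
  split_ifs
  · exact h n _ _
  · simpa using hε0 n

/-! ### Existence and uniqueness of mild solutions -/

section Main

variable {Ω Z V : Type*} [MeasurableSpace Ω] [MeasurableSpace Z]
  [NormedAddCommGroup V] [NormedSpace ℝ V] [CompleteSpace V]
  [TopologicalSpace.SeparableSpace V] [MeasurableSpace V] [BorelSpace V]
  {P : Measure Ω} {Θ : Ω → PointFunction Z} {A : V → Set V} {G : V → V}
  {Vstar : Set (StrongDual ℝ V)} {x : Ω → V} {η η' : ℝ → Z → Ω → V}

theorem IsFinitePP.isStrongSolution_generatedSol [P.IsComplete] (hΘ : IsFinitePP P Θ)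
    (hA : IsMAccretive A) (hdense : Dense (opDomain A))
    (hdom : IsDomainInvariant A) (hG : IsInfinitesimalGenerator A G)
    {W : Submodule ℝ V} (hWinv : IsInvariantSet A (W : Set V))
    (hint : ∀ t : ℝ, 0 < t → ∀ u ∈ W, ∀ Ψ ∈ Vstar,
      IntegrableOn (fun τ => Ψ (G (semigroup A τ u))) (Ioo 0 t))
    (hx : Measurable x) (hη : IsMeasurableDrift η)
    (hxW : ∀ ω, x ω ∈ W) (hηW : ∀ s z ω, η s z ω ∈ W) :
    IsStrongSolution P Θ A G Vstar x η (generatedSol A Θ x η) := by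
  refine ⟨hΘ.isJointlyMeasurable_generatedSol hA hdense hx hη, ?_⟩
  filter_upwards [hΘ.ae_isLocallyFinite] with ω hω
  have hi : ∀ Ψ ∈ Vstar, ∀ m, ∀ t : ℝ, 0 < t → IntegrableOn
      (fun τ => Ψ (G (semigroup A τ (jumpSequence A Θ x η m ω)))) (Ioo 0 t) := fun Ψ hΨ m t ht =>
    hint t ht _ (jumpSequence_mem hWinv (hxW ω) (fun s z => hηW s z ω) m) Ψ hΨ
  refine ⟨isRegularPath_generatedSol hA hdense hdom hG hω, fun t ht Ψ hΨ => ?_,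
    fun t ht Ψ hΨ => ?_⟩
  · obtain ⟨m, hm⟩ := hω.exists_mem_Ico t
    exact (integral_generatedSol hA hdense hdom hG Ψ (hi Ψ hΨ) ht.le hm).1
  · obtain ⟨m, hm⟩ := hω.exists_mem_Ico t
    rw [setIntegral_dual_drift hω hη hm]
    exact (integral_generatedSol hA hdense hdom hG Ψ (hi Ψ hΨ) ht.le hm).2

theorem IsStrongSolution.ae_eq_generatedSol (hΘ : IsFinitePP P Θ)
    (hA : IsMAccretive A) (hdense : Dense (opDomain A))
    (hdom : IsDomainInvariant A) (hG : IsInfinitesimalGenerator A G) (hV : IsSeparatingSet Vstar)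
    (hη : IsMeasurableDrift η) {X : ℝ → Ω → V} (hX : IsStrongSolution P Θ A G Vstar x η X) :
    ∀ᵐ ω ∂P, ∀ t : ℝ, 0 ≤ t → X t ω = generatedSol A Θ x η t ω := by
  filter_upwards [hΘ.ae_isLocallyFinite, hX.2] with ω hω ⟨h1, h2, h3⟩ t ht
  refine h1.eq_generatedSol hA hdense hdom hG hV hω h2 (fun t ht Ψ hΨ m hm => ?_) ht
  rw [h3 t ht Ψ hΨ, setIntegral_dual_drift hω hη hm]

/-- Enlarging the integral from `(0, s]` to `(0, t]` makes the stability bound uniform in `s ≤ t`.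
-/
theorem enorm_generatedSol_sub_le (hA : IsMAccretive A) (hdense : Dense (opDomain A)) {ω : Ω}
    (hω : (Θ ω).IsLocallyFinite) (hη : IsMeasurableDrift η) (hη' : IsMeasurableDrift η')
    (x x' : Ω → V) {s t : ℝ} (hst : s ≤ t) :
    ‖generatedSol A Θ x η s ω - generatedSol A Θ x' η' s ω‖ₑ ≤ ‖x ω - x' ω‖ₑ +
      ∫⁻ p in Ioc 0 t ×ˢ univ, ‖η p.1 p.2 ω - η' p.1 p.2 ω‖ₑ ∂(Θ ω).countingMeasure := by
  obtain ⟨m, hm⟩ := hω.exists_mem_Ico s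
  refine le_trans ?_ (add_le_add_right (lintegral_mono_set
    (prod_mono_left (Ioc_subset_Ioc_right hst))) _)
  rw [setLIntegral_enorm_sub_drift hω hη hη' hm]
  simp only [← ofReal_norm]
  rw [← ENNReal.ofReal_sum_of_nonneg fun _ _ => norm_nonneg _,
    ← ENNReal.ofReal_add (norm_nonneg _) (Finset.sum_nonneg fun _ _ => norm_nonneg _)]
  exact ENNReal.ofReal_le_ofReal (norm_generatedSol_sub_le hA hdense x x' η η' hm)

theorem IsFinitePP.isMildSolution_generatedSol [P.IsComplete] (hΘ : IsFinitePP P Θ)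
    (hA : IsMAccretive A) (hdense : Dense (opDomain A))
    (hdom : IsDomainInvariant A) (hG : IsInfinitesimalGenerator A G)
    {W : Submodule ℝ V} (hW : Dense (W : Set V)) (hWinv : IsInvariantSet A (W : Set V))
    (hint : ∀ t : ℝ, 0 < t → ∀ u ∈ W, ∀ Ψ ∈ Vstar,
      IntegrableOn (fun τ => Ψ (G (semigroup A τ u))) (Ioo 0 t))
    (hx : Measurable x) (hη : IsMeasurableDrift η) :
    IsMildSolution P Θ A G Vstar x η (generatedSol A Θ x η) := by
  -- One map `f n` with values in `W`, uniformly `eulerStep n`-close to the identity, is applied to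
  -- `x` and `η` alike; composition preserves measurability.
  choose f hfm hf using fun n => exists_measurable_approx hW (eulerStep_pos n)
  have hηs : ∀ n, IsMeasurableDrift fun s z ω => f n (η s z ω) := fun n => (hfm n).comp hη
  refine ⟨hΘ.isJointlyMeasurable_generatedSol hA hdense hx hη, ?_, fun n ω => f n (x ω),
    fun n s z ω => f n (η s z ω), fun n => generatedSol A Θ _ _,
    fun n => ⟨(hfm n).comp hx, hηs n⟩,
    fun n => hΘ.isStrongSolution_generatedSol hA hdense hdom hG hWinv hint ((hfm n).comp hx)
      (hηs n) (fun ω => (hf n _).1) (fun s z ω => (hf n _).1), ?_, ?_⟩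
  · filter_upwards [hΘ.ae_isLocallyFinite] with ω hω
    exact isRegularPath_generatedSol hA hdense hdom hG hω
  · filter_upwards [hΘ.ae_isLocallyFinite] with ω hω t ht
    rw [EMetric.tendstoUniformlyOn_iff]
    intro ε hε
    have l1 : Tendsto (fun n => ENNReal.ofReal (eulerStep n)) atTop (𝓝 0) := by
      simpa using ENNReal.tendsto_ofReal tendsto_eulerStep
    have l2 := l1.add (tendsto_lintegral_drift hω hηs hη tendsto_eulerStep
      (fun n => (eulerStep_pos n).le) (fun n s z => (hf n (η s z ω)).2) t)
    rw [add_zero] at l2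
    filter_upwards [l2.eventually (gt_mem_nhds hε)] with n hn s hs
    rw [edist_comm, edist_eq_enorm_sub]
    refine ((enorm_generatedSol_sub_le hA hdense hω (hηs n) hη _ x hs.2).trans
      (add_le_add_left ?_ _)).trans_lt hn
    rw [← ofReal_norm]
    exact ENNReal.ofReal_le_ofReal (hf n (x ω)).2
  · filter_upwards [hΘ.ae_isLocallyFinite] with ω hω t _
    exact tendsto_lintegral_drift hω hηs hη tendsto_eulerStep
      (fun n => (eulerStep_pos n).le) (fun n s z => (hf n (η s z ω)).2) t

theorem IsMildSolution.ae_eq_generatedSol (hΘ : IsFinitePP P Θ)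
    (hA : IsMAccretive A) (hdense : Dense (opDomain A))
    (hdom : IsDomainInvariant A) (hG : IsInfinitesimalGenerator A G) (hV : IsSeparatingSet Vstar)
    (hη : IsMeasurableDrift η) {Y : ℝ → Ω → V} (hY : IsMildSolution P Θ A G Vstar x η Y) :
    ∀ᵐ ω ∂P, ∀ t : ℝ, 0 ≤ t → Y t ω = generatedSol A Θ x η t ω := by
  obtain ⟨-, hreg, xs, ηs, Xs, hmeas, hstrong, hunif, hconv⟩ := hY
  filter_upwards [hΘ.ae_isLocallyFinite, hreg, hunif, hconv, ae_all_iff.2 fun n =>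
    (hstrong n).ae_eq_generatedSol hΘ hA hdense hdom hG hV (hmeas n).2] with ω hω h1 h2 h3 h4 t ht
  have ht1 : 0 < t + 1 := by linarith
  have hu := h2 (t + 1) ht1
  -- Convergence of the initial data is not part of the definition; it follows from uniform
  -- convergence at time `0`.
  have lx : Tendsto (fun n => xs n ω) atTop (𝓝 (x ω)) := by
    have := hu.tendsto_at (x := 0) ⟨le_rfl, ht1.le⟩
    rw [h1.initial] at this
    refine this.congr fun n => ?_
    rw [h4 n 0 le_rfl, generatedSol_zero hA hdense hω]
  have lY : Tendsto (fun n => generatedSol A Θ (xs n) (ηs n) t ω) atTop (𝓝 (Y t ω)) :=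
    (hu.tendsto_at ⟨ht, by linarith⟩).congr fun n => h4 n t ht
  -- By stability the same sequence also converges to the process generated by `(x, η)`.
  refine tendsto_nhds_unique lY (tendsto_iff_edist_tendsto_0.2 ?_)
  have lim := (tendsto_iff_edist_tendsto_0.1 lx).add (h3 (t + 1) ht1)
  rw [add_zero] at lim
  refine tendsto_of_tendsto_of_tendsto_of_le_of_le tendsto_const_nhds lim (fun _ => zero_le)
    fun n => ?_
  simp only [edist_eq_enorm_sub]
  exact enorm_generatedSol_sub_le hA hdense hω (hmeas n).2 hη (xs n) x (by linarith)

end Main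

end ACPRM

theorem mainTheorem1
    {Ω Z V : Type*} [MeasurableSpace Ω] [MeasurableSpace Z]
    [NormedAddCommGroup V] [NormedSpace ℝ V] [CompleteSpace V]
    [TopologicalSpace.SeparableSpace V] [MeasurableSpace V] [BorelSpace V]
    (P : Measure Ω) [IsProbabilityMeasure P] [P.IsComplete]
    (Θ : Ω → PointFunction Z) (hΘ : IsFinitePP P Θ)
    (A : V → Set V) (hA : IsMAccretive A) (hdense : Dense (opDomain A))
    (hdom : IsDomainInvariant A)
    (G : V → V) (hG : IsInfinitesimalGenerator A G)
    (W : Submodule ℝ V) (hW : Dense (W : Set V)) (hWinv : IsInvariantSet A (W : Set V))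
    (Vstar : Set (StrongDual ℝ V)) (hVstar : IsSeparatingSet Vstar)
    (hint : ∀ t : ℝ, 0 < t → ∀ u ∈ W, ∀ Ψ ∈ Vstar,
      IntegrableOn (fun τ => Ψ (G (semigroup A τ u))) (Ioo 0 t))
    (x : Ω → V) (hx : Measurable x)
    (η : ℝ → Z → Ω → V) (hη : IsMeasurableDrift η) :
    IsMildSolution P Θ A G Vstar x η (generatedSol A Θ x η) ∧
    (∀ Y : ℝ → Ω → V, IsMildSolution P Θ A G Vstar x η Y →
      ∀ᵐ ω ∂P, ∀ t : ℝ, 0 ≤ t → Y t ω = generatedSol A Θ x η t ω) ∧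
    ((0 : V) ∈ A 0 →
      ∀ᵐ ω ∂P, ∀ t : ℝ, 0 ≤ t →
        IntegrableOn (fun p : ℝ × Z => ‖η p.1 p.2 ω‖) (Ioc 0 t ×ˢ univ)
          (Θ ω).countingMeasure ∧
        ‖generatedSol A Θ x η t ω‖ ≤
          ‖x ω‖ + ∫ p in Ioc 0 t ×ˢ univ, ‖η p.1 p.2 ω‖ ∂(Θ ω).countingMeasure) := by
  refine ⟨hΘ.isMildSolution_generatedSol hA hdense hdom hG hW hWinv hint hx hη,
    fun Y hY => hY.ae_eq_generatedSol hΘ hA hdense hdom hG hVstar hη, fun h0 => ?_⟩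
  filter_upwards [hΘ.ae_isLocallyFinite] with ω hω t _
  obtain ⟨m, hm⟩ := hω.exists_mem_Ico t
  refine ⟨hω.integrableOn_countingMeasure t (stronglyMeasurable_indicator_norm_drift hη ω), ?_⟩
  rw [setIntegral_norm_drift hω hη hm]
  exact norm_generatedSol_le hA hdense h0 x η hm
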